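/- Let $\Pi$ be an irreducible reduced crystallographic root system spanning a Euclidean space $V\cong\mathbb{R}^n$ with scalar product $\langle\cdot,\cdot\rangle$, with simple roots $\alpha_1,\dots,\alpha_n$ and highest root $\xi$ (the root with $\xi-\beta\in\sum_i\mathbb{Z}_{\ge0}\alpha_i$ for every root $\beta$), the scalar product being normalized by $\langle\xi,\xi\rangle=2$. Put $\alpha_i^\vee=2\alpha_i/\langle\alpha_i,\alpha_i\rangle$, $Q^\vee=\sum_i\mathbb{Z}\alpha_i^\vee$, $P=\{\omega\in V:\langle\omega,q\rangle\in\mathbb{Z}\ \text{for all } q\in Q^\vee\}$ and $d=|P/Q^\vee|$. Let $W$ be the Weyl group, generated by the reflections $r_i a=a-\langle\alpha_i,a\rangle\alpha_i^\vee$, let $W^{\mathrm{aff}}=T(Q^\vee)\rtimes W$ be the affine Weyl group acting on $V$, and let $\psi:W^{\mathrm{aff}}\to W$, $\psi(T(q)w)=w$. For $a\in V$ and a positive integer $M$ put $$h(a)=|\mathrm{Stab}_{W^{\mathrm{aff}}}(a)|,\qquad h_M(a)=h(a/M),\qquad \varepsilon(a)=|W|/h(a).$$ Let $F=\{a\in V:\langle\alpha_i,a\rangle\ge0\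 (1\le i\le n),\ \langle\xi,a\rangle\le1\}$ be the fundamental domain of $W^{\mathrm{aff}}$. For a homomorphism $\sigma:W\to\{\pm1\}$ let $$F^\sigma=\{a\in F:\sigma(\psi(g))=1\ \text{for all } g\in\mathrm{Stab}_{W^{\mathrm{aff}}}(a)\},\qquad F^\sigma_{P,M}=\tfrac1M P\cap F^\sigma,\qquad \Lambda^\sigma_{P,M}=P\cap MF^\sigma,$$ and for $\lambda\in P$ let $\phi^\sigma_\lambda(a)=\sum_{w\in W}\sigma(w)\,e^{2\pi i\langle w\lambda,a\rangle}$, $a\in V$. Then, for every homomorphism $\sigma:W\to\{\pm1\}$ and every positive integer $M$, the set $F^\sigma_{P,M}$ is finite, and for all $\lambda,\lambda'\in\Lambda^\sigma_{P,M}$, $$\sum_{a\in F^\sigma_{P,M}}\varepsilon(a)\,\phi^\sigma_\lambda(a)\,\overline{\phi^\sigma_{\lambda'}(a)}=d\,|W|\,M^n\,h_M(\lambda)\,\delta_{\lambda,\lambda'}.$$ -/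

import Mathlib

open scoped Pointwise

namespace WeylOrbit

variable {ι V : Type*} [NormedAddCommGroup V] [InnerProductSpace ℝ V]

/-- A root pairing of a real inner product space `V` with itself is Euclidean if its pairing is the
scalar product of `V` and its coroots are `α^∨ = 2 α / ⟨α, α⟩`. -/
structure IsEuclidean (Φ : RootPairing ι ℝ V V) : Prop where
  pairing_eq : ∀ x y : V, Φ.toLinearMap x y = inner ℝ x y
  coroot_eq : ∀ i : ι, Φ.coroot i = (2 / inner ℝ (Φ.root i) (Φ.root i) : ℝ) • Φ.root i

variable {Φ : RootPairing ι ℝ V V}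

/-- `ξ` is (the index of) the highest root: every root `β` satisfies `β ≤ ξ`, that is, `ξ - β` is a
combination of simple roots with non-negative integer coefficients. -/
def IsHighestRoot (b : Φ.Base) (ξ : ι) : Prop :=
  ∀ j : ι, Φ.root ξ - Φ.root j ∈ AddSubmonoid.closure (Φ.root '' b.support)

/-- The dual root lattice `Q^∨`, spanned over `ℤ` by the simple coroots. -/
def corootLattice (b : Φ.Base) : AddSubgroup V :=
  AddSubgroup.closure (Φ.coroot '' b.support)

/-- The weight lattice `P`, the `ℤ`-dual of `Q^∨`. -/
def weightLattice (b : Φ.Base) : AddSubgroup V where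
  carrier := {x | ∀ q ∈ corootLattice b, ∃ k : ℤ, inner ℝ x q = (k : ℝ)}
  zero_mem' := fun q _ => ⟨0, by simp⟩
  add_mem' := by
    intro x y hx hy q hq
    obtain ⟨k, hk⟩ := hx q hq
    obtain ⟨l, hl⟩ := hy q hq
    exact ⟨k + l, by rw [inner_add_left, hk, hl]; push_cast; rfl⟩
  neg_mem' := by
    intro x hx q hq
    obtain ⟨k, hk⟩ := hx q hq
    exact ⟨-k, by rw [inner_neg_left, hk]; push_cast; rfl⟩

/-- The Weyl group `W`, generated by the simple reflections
`r_α a = a - ⟨α, a⟩ α^∨` (these are the maps `Φ.coreflection i`). -/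
def weylGroup (b : Φ.Base) : Subgroup (V ≃ₗ[ℝ] V) :=
  Subgroup.closure (Φ.coreflection '' b.support)

lemma weylGroup_map_coroot (b : Φ.Base) {w : V ≃ₗ[ℝ] V} (hw : w ∈ weylGroup b) :
    ∀ i : ι, ∃ j : ι, w (Φ.coroot i) = Φ.coroot j := by
  induction hw using Subgroup.closure_induction'' with
  | mem x hx =>
    obtain ⟨k, -, rfl⟩ := hx
    exact fun i => ⟨Φ.reflectionPerm k i, by simp⟩
  | inv_mem x hx =>
    obtain ⟨k, -, rfl⟩ := hx
    exact fun i => ⟨Φ.reflectionPerm k i, by simp⟩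
  | one => exact fun i => ⟨i, rfl⟩
  | mul x y _ _ hx hy =>
    intro i
    obtain ⟨j, hj⟩ := hy i
    obtain ⟨k, hk⟩ := hx j
    exact ⟨k, by rw [LinearEquiv.mul_apply, hj, hk]⟩

instance finite_weylGroup [Finite ι] [Φ.IsRootSystem] (b : Φ.Base) : Finite (weylGroup b) := by
  choose f hf using fun w : weylGroup b => weylGroup_map_coroot b w.2
  refine Finite.of_injective f fun w w' h => Subtype.ext (LinearEquiv.toLinearMap_injective ?_)
  refine LinearMap.ext_on_range (v := Φ.coroot) RootPairing.IsRootSystem.span_coroot_eq_top fun i => ?_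
  exact (hf w i).trans ((congrArg Φ.coroot (congrFun h i)).trans (hf w' i).symm)

noncomputable instance fintype_weylGroup [Finite ι] [Φ.IsRootSystem] (b : Φ.Base) :
    Fintype (weylGroup b) :=
  Fintype.ofFinite _

lemma weylGroup_map_corootLattice (b : Φ.Base) {w : V ≃ₗ[ℝ] V}
    (hw : w ∈ weylGroup b) {q : V} (hq : q ∈ corootLattice b) : w q ∈ corootLattice b := by
  have hcor : ∀ i : ι, Φ.coroot i ∈ corootLattice b := by
    intro i
    have hle : AddSubmonoid.closure (Φ.coroot '' b.support) ≤ (corootLattice b).toAddSubmonoid :=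
      AddSubmonoid.closure_le.mpr AddSubgroup.subset_closure
    rcases b.coroot_mem_or_neg_mem i with h | h
    · exact hle h
    · exact (neg_mem_iff (x := Φ.coroot i)).mp (hle h)
  induction hq using AddSubgroup.closure_induction with
  | mem x hx =>
    obtain ⟨i, -, rfl⟩ := hx
    obtain ⟨j, hj⟩ := weylGroup_map_coroot b hw i
    exact hj ▸ hcor j
  | zero => simp
  | add x y _ _ hx hy => rw [map_add]; exact add_mem hx hy
  | neg x _ hx => rw [map_neg]; exact neg_mem hx

/-- The affine Weyl group `W^aff = T(Q^∨) ⋊ W`: the affine maps `a ↦ w a + q` with `w ∈ W` (the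
linear part) and `q ∈ Q^∨` (the image of the origin). -/
def affineWeylGroup (b : Φ.Base) : Subgroup (V ≃ᵃ[ℝ] V) where
  carrier := {g | g.linear ∈ weylGroup b ∧ g 0 ∈ corootLattice b}
  one_mem' := ⟨one_mem (weylGroup b), zero_mem (corootLattice b)⟩
  mul_mem' := by
    intro g g' hg hg'
    refine ⟨mul_mem hg.1 hg'.1, ?_⟩
    have h : (g * g') 0 = g.linear (g' 0) + g 0 := by
      simpa using g.map_vadd 0 (g' 0)
    rw [h]
    exact add_mem (weylGroup_map_corootLattice b hg.1 hg'.2) hg.2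
  inv_mem' := by
    intro g hg
    have hl : g⁻¹.linear ∈ weylGroup b := inv_mem hg.1
    refine ⟨hl, ?_⟩
    have h : g⁻¹ 0 = -g⁻¹.linear (g 0) := by
      have h1 := g⁻¹.map_vadd 0 (g 0)
      have h2 : g⁻¹ (g 0) = 0 := g.symm_apply_apply 0
      simp only [vadd_eq_add, add_zero, h2] at h1
      exact eq_neg_of_add_eq_zero_right h1.symm
    rw [h]
    exact neg_mem (weylGroup_map_corootLattice b hl hg.2)

/-- The retraction homomorphism `ψ : W^aff → W`, `T(q) w ↦ w`. -/
def retraction (b : Φ.Base) : affineWeylGroup b →* weylGroup b where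
  toFun g := ⟨g.1.linear, g.2.1⟩
  map_one' := rfl
  map_mul' _ _ := rfl

/-- The isotropy subgroup `Stab_{W^aff}(a)`. -/
def affineStabilizer (b : Φ.Base) (a : V) : Subgroup (affineWeylGroup b) where
  carrier := {g | g.1 a = a}
  one_mem' := rfl
  mul_mem' := by
    intro g g' hg hg'
    exact (congrArg g.1 hg').trans hg
  inv_mem' := by
    intro g hg
    exact (AffineEquiv.symm_apply_eq g.1).mpr (Eq.symm hg)

instance finite_affineStabilizer [Finite ι] [Φ.IsRootSystem] (b : Φ.Base) (a : V) :
    Finite (affineStabilizer b a) := by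
  refine Finite.of_injective (fun g : affineStabilizer b a => retraction b g.1) fun g g' h => ?_
  have hl : g.1.1.linear = g'.1.1.linear := congrArg Subtype.val h
  refine Subtype.ext (Subtype.ext (AffineEquiv.ext fun x => ?_))
  have h1 := g.1.1.map_vadd a (x - a)
  have h2 := g'.1.1.map_vadd a (x - a)
  have hg : g.1.1 a = a := g.2
  have hg' : g'.1.1 a = a := g'.2
  simp only [vadd_eq_add, sub_add_cancel, hg, hg'] at h1 h2
  rw [h1, h2, hl]

/-- `h(a) = |Stab_{W^aff}(a)|`. -/
noncomputable def stabOrder (b : Φ.Base) (a : V) : ℕ :=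
  Nat.card (affineStabilizer b a)

/-- `h_M(a) = |Stab_{W^aff}(a / M)|`. -/
noncomputable def stabOrderScaled (b : Φ.Base) (M : ℕ) (a : V) : ℕ :=
  stabOrder b ((M : ℝ)⁻¹ • a)

/-- `ε(a) = |W| / h(a)`. -/
noncomputable def orbitWeight (b : Φ.Base) (a : V) : ℝ :=
  (Nat.card (weylGroup b) : ℝ) / (stabOrder b a : ℝ)

/-- The fundamental domain `F` of `W^aff`. The coordinates of `a` in the basis of fundamental
coweights are `y_i = ⟨α_i, a⟩`, and `∑ m_i y_i = ⟨ξ, a⟩` for the marks `m_i` of the highest root;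
so `y_i ≥ 0` for all `i` and `y_0 = 1 - ∑ m_i y_i ≥ 0` are the conditions below. -/
def fundamentalDomain (b : Φ.Base) (ξ : ι) : Set V :=
  {a | (∀ i ∈ b.support, 0 ≤ inner ℝ (Φ.root i) a) ∧ inner ℝ (Φ.root ξ) a ≤ 1}

/-- `F^σ = {a ∈ F | σ ∘ ψ (Stab_{W^aff}(a)) = {1}}`. -/
def signedDomain (b : Φ.Base) (ξ : ι) (σ : weylGroup b →* ℤˣ) : Set V :=
  {a | a ∈ fundamentalDomain b ξ ∧ ∀ g ∈ affineStabilizer b a, σ (retraction b g) = 1}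

/-- The grid `F^σ_{P,M} = (1/M) P ∩ F^σ`. -/
def argumentGrid (b : Φ.Base) (ξ : ι) (σ : weylGroup b →* ℤˣ) (M : ℕ) : Set V :=
  ((M : ℝ)⁻¹ • (weightLattice b : Set V)) ∩ signedDomain b ξ σ

/-- The set of labels `Λ^σ_{P,M} = P ∩ M F^σ`. -/
def labelGrid (b : Φ.Base) (ξ : ι) (σ : weylGroup b →* ℤˣ) (M : ℕ) : Set V :=
  (weightLattice b : Set V) ∩ ((M : ℝ) • signedDomain b ξ σ)

/-- The orbit function `φ^σ_λ(a) = ∑_{w ∈ W} σ(w) exp(2 π i ⟨w λ, a⟩)`. -/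
noncomputable def orbitFunction [Finite ι] [Φ.IsRootSystem] (b : Φ.Base)
    (σ : weylGroup b →* ℤˣ) (l a : V) : ℂ :=
  ∑ w : weylGroup b, (((σ w : ℤˣ) : ℤ) : ℂ) *
    Complex.exp (2 * Real.pi * Complex.I * ((inner ℝ (w.1 l) a : ℝ) : ℂ))

/-- The scalar product `∑_{a ∈ F^σ_{P,M}} ε(a) f(a) conj(g(a))` (the index set is finite). -/
noncomputable def gridInner (b : Φ.Base) (ξ : ι) (σ : weylGroup b →* ℤˣ) (M : ℕ)
    (f g : V → ℂ) : ℂ :=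
  ∑ᶠ a ∈ argumentGrid b ξ σ M, (orbitWeight b a : ℂ) * f a * (starRingEnd ℂ) (g a)

/-- `d = |P / Q^∨|`. -/
noncomputable def latticeIndex (b : Φ.Base) : ℕ :=
  (corootLattice b).relIndex (weightLattice b)

end WeylOrbit

namespace WeylOrbit

variable {ι V : Type*} [NormedAddCommGroup V] [InnerProductSpace ℝ V]
variable {Φ : RootPairing ι ℝ V V}

/-! ### Reflections and the finite Weyl group in the Euclidean setting -/

/-! Two facts drive the theorem: `F` is a strict fundamental domain of the affine Weyl group, and
the characters of the finite group (1/M)P/Q^∨ are orthogonal.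

The product of one orbit function with the conjugate of another is invariant under W^aff, because
the signs square to one, and it vanishes at points of `F` outside F^σ. The weight ε(a) = |W|/h(a) is
the number of classes modulo Q^∨ in the W-orbit of a, so the weighted grid sum is a plain sum over
(1/M)P/Q^∨ (`sum_gridRep_eq`, `gridInner_orbitFunction`). Expanding both orbit functions and
applying `sum_expInner` leaves d |W| M^n times the sum of σ(u) over those u in W with λ/M - u(λ'/M)
in Q^∨ (`sum_orbitFunction_mul_conj`). Both λ/M and λ'/M lie in `F`, so such a u forces λ = λ'.
These u are then the linear parts of the stabilizer of λ/M, on which σ is trivial, and they number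
h_M(λ).

The geometric input is `exists_mem_fundamentalDomain` (nearest orbit point to an interior point) and
`eq_of_mem_fundamentalDomain` (an exchange argument on words in the simple affine reflections). The
normalization ⟨ξ, ξ⟩ = 2 enters through the maximal length of the highest root. This makes the
affine wall behave like a simple one (`eq_of_separates`), gives Q^∨ ⊆ P, and shows that the W-orbit
of ξ^∨ generates Q^∨. -/

lemma IsEuclidean.inner_root_coroot (hΦ : IsEuclidean Φ) (i j : ι) :
    inner ℝ (Φ.root i) (Φ.coroot j) = Φ.pairing i j := by
  rw [← hΦ.pairing_eq, Φ.root_coroot_eq_pairing]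

lemma IsEuclidean.coreflection_apply (hΦ : IsEuclidean Φ) (i : ι) (x : V) :
    Φ.coreflection i x = x - inner ℝ (Φ.root i) x • Φ.coroot i := by
  rw [← hΦ.pairing_eq]; rfl

/-- The scalar product identifies V with its dual, so one group W acts on both roots and coroots. -/
lemma IsEuclidean.coreflection_eq_reflection (hΦ : IsEuclidean Φ) (i : ι) :
    Φ.coreflection i = Φ.reflection i := by
  ext x
  rw [hΦ.coreflection_apply, Φ.reflection_apply]
  change _ = x - (Φ.toLinearMap x (Φ.coroot i)) • _
  rw [hΦ.pairing_eq, hΦ.coroot_eq, inner_smul_right, smul_smul, real_inner_comm, mul_comm]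

lemma inner_root_self_pos (Φ : RootPairing ι ℝ V V) (i : ι) :
    0 < inner ℝ (Φ.root i) (Φ.root i) :=
  real_inner_self_pos.mpr (Φ.ne_zero i)

lemma IsEuclidean.inner_coroot_right (hΦ : IsEuclidean Φ) (i : ι) (x : V) :
    inner ℝ x (Φ.coroot i) = 2 / inner ℝ (Φ.root i) (Φ.root i) * inner ℝ (Φ.root i) x := by
  rw [hΦ.coroot_eq, inner_smul_right, real_inner_comm x]

lemma IsEuclidean.inner_coreflection (hΦ : IsEuclidean Φ) (i : ι) (x y : V) :
    inner ℝ (Φ.coreflection i x) (Φ.coreflection i y) = inner ℝ x y := by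
  have h := (inner_root_self_pos Φ i).ne'
  simp only [hΦ.coreflection_apply, hΦ.coroot_eq, inner_sub_left, inner_sub_right,
    inner_smul_left, inner_smul_right, real_inner_comm (Φ.root i) x]
  simp only [map_div₀, conj_trivial]
  field_simp
  ring

lemma weylGroup_inner (hΦ : IsEuclidean Φ) {b : Φ.Base} {w : V ≃ₗ[ℝ] V} (hw : w ∈ weylGroup b)
    (x y : V) : inner ℝ (w x) (w y) = inner ℝ x y := by
  induction hw using Subgroup.closure_induction'' generalizing x y with
  | mem w hw =>
    obtain ⟨i, -, rfl⟩ := hw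
    exact hΦ.inner_coreflection i x y
  | inv_mem w hw =>
    obtain ⟨i, -, rfl⟩ := hw
    exact hΦ.inner_coreflection i x y
  | one => rfl
  | mul u v _ _ hu hv => rw [LinearEquiv.mul_apply, LinearEquiv.mul_apply, hu, hv]

lemma weylGroup_inner_left (hΦ : IsEuclidean Φ) {b : Φ.Base} {w : V ≃ₗ[ℝ] V}
    (hw : w ∈ weylGroup b) (x y : V) : inner ℝ (w x) y = inner ℝ x (w⁻¹ y) := by
  rw [← weylGroup_inner hΦ hw x (w⁻¹ y), ← LinearEquiv.mul_apply, mul_inv_cancel]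
  rfl

/-- The Weyl group permutes roots and coroots simultaneously. -/
lemma weylGroup_map_root (hΦ : IsEuclidean Φ) {b : Φ.Base} {w : V ≃ₗ[ℝ] V} (hw : w ∈ weylGroup b)
    (i : ι) : ∃ j, w (Φ.root i) = Φ.root j ∧ w (Φ.coroot i) = Φ.coroot j := by
  induction hw using Subgroup.closure_induction'' generalizing i with
  | mem x hx =>
    obtain ⟨k, -, rfl⟩ := hx
    exact ⟨Φ.reflectionPerm k i, by simp [hΦ.coreflection_eq_reflection k], by simp⟩
  | inv_mem x hx =>
    obtain ⟨k, -, rfl⟩ := hx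
    exact ⟨Φ.reflectionPerm k i, by simp [hΦ.coreflection_eq_reflection k], by simp⟩
  | one => exact ⟨i, rfl, rfl⟩
  | mul x y _ _ hx hy =>
    obtain ⟨j, hj, hj'⟩ := hy i
    obtain ⟨k, hk, hk'⟩ := hx j
    exact ⟨k, by rw [LinearEquiv.mul_apply, hj, hk], by rw [LinearEquiv.mul_apply, hj', hk']⟩

/-- All reflections, not only the simple ones, belong to the Weyl group. -/
lemma coreflection_mem_weylGroup [Finite ι] [Φ.IsCrystallographic] [Φ.IsReduced] (b : Φ.Base)
    (i : ι) : Φ.coreflection i ∈ weylGroup b := by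
  induction i using b.induction_reflect with
  | h₀ i hi =>
    have : Φ.coreflection (Φ.reflectionPerm i i) = Φ.coreflection i * Φ.coreflection i *
        Φ.coreflection i := Φ.flip.reflection_reflectionPerm
    rw [this]
    exact mul_mem (mul_mem hi hi) hi
  | h₁ i hi => exact Subgroup.subset_closure ⟨i, hi, rfl⟩
  | h₂ i j hi hj =>
    have hj : Φ.coreflection j ∈ weylGroup b := Subgroup.subset_closure ⟨j, hj, rfl⟩
    have : Φ.coreflection (Φ.reflectionPerm j i) = Φ.coreflection j * Φ.coreflection i *
        Φ.coreflection j := Φ.flip.reflection_reflectionPerm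
    rw [this]
    exact mul_mem (mul_mem hj hi) hj

lemma coroot_mem_corootLattice (b : Φ.Base) (i : ι) : Φ.coroot i ∈ corootLattice b := by
  have hle : AddSubmonoid.closure (Φ.coroot '' b.support) ≤ (corootLattice b).toAddSubmonoid :=
    AddSubmonoid.closure_le.mpr AddSubgroup.subset_closure
  rcases b.coroot_mem_or_neg_mem i with h | h
  · exact hle h
  · exact (neg_mem_iff (x := Φ.coroot i)).mp (hle h)

lemma exists_inner_root_eq_int (hΦ : IsEuclidean Φ) [Φ.IsCrystallographic] {b : Φ.Base} (i : ι)
    {q : V} (hq : q ∈ corootLattice b) : ∃ k : ℤ, inner ℝ (Φ.root i) q = (k : ℝ) := by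
  induction hq using AddSubgroup.closure_induction with
  | mem x hx =>
    obtain ⟨j, -, rfl⟩ := hx
    exact ⟨Φ.pairingIn ℤ i j, by rw [hΦ.inner_root_coroot, ← Φ.algebraMap_pairingIn ℤ]; rfl⟩
  | zero => exact ⟨0, by simp⟩
  | add x y _ _ hx hy =>
    obtain ⟨k, hk⟩ := hx
    obtain ⟨l, hl⟩ := hy
    exact ⟨k + l, by rw [inner_add_right, hk, hl]; push_cast; rfl⟩
  | neg x _ hx =>
    obtain ⟨k, hk⟩ := hx
    exact ⟨-k, by rw [inner_neg_right, hk]; push_cast; rfl⟩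

lemma root_mem_weightLattice (hΦ : IsEuclidean Φ) [Φ.IsCrystallographic] (b : Φ.Base) (i : ι) :
    Φ.root i ∈ weightLattice b :=
  fun _ hq => exists_inner_root_eq_int hΦ i hq

lemma inner_nonneg_of_mem_closure {b : Φ.Base} {a x : V}
    (ha : ∀ i ∈ b.support, 0 ≤ inner ℝ (Φ.root i) a)
    (hx : x ∈ AddSubmonoid.closure (Φ.root '' b.support)) : 0 ≤ inner ℝ x a := by
  induction hx using AddSubmonoid.closure_induction with
  | mem x hx => obtain ⟨i, hi, rfl⟩ := hx; exact ha i hi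
  | zero => simp
  | add x y _ _ hx hy => rw [inner_add_left]; exact add_nonneg hx hy

/-- A vector with prescribed scalar products against a basis. -/
lemma exists_inner_basis_eq {κ : Type*} [Finite κ] (B : Module.Basis κ ℝ V) (c : κ → ℝ) :
    ∃ x : V, ∀ i, inner ℝ (B i) x = c i := by
  have : FiniteDimensional ℝ V := Module.Finite.of_basis B
  refine ⟨(InnerProductSpace.toDual ℝ V).symm (LinearMap.toContinuousLinearMap (B.constr ℝ c)),
    fun i => ?_⟩
  rw [real_inner_comm, InnerProductSpace.toDual_symm_apply]
  simp

/-! ### The open alcove and the signs of roots on it -/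

/-- The interior of the fundamental domain. -/
def openAlcove (b : Φ.Base) (ξ : ι) : Set V :=
  {a | (∀ i ∈ b.support, 0 < inner ℝ (Φ.root i) a) ∧ inner ℝ (Φ.root ξ) a < 1}

lemma openAlcove_nonempty [Φ.IsRootSystem] (b : Φ.Base) (ξ : ι) :
    (openAlcove b ξ).Nonempty := by
  obtain ⟨x, hx⟩ := exists_inner_basis_eq b.toWeightBasis fun _ => (1 : ℝ)
  set t : ℝ := inner ℝ (Φ.root ξ) x
  have ht : 0 < 1 + |t| := by positivity
  -- Every simple root takes the value 1 at x; shrinking x by 1 + |t| keeps these values positive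
  -- and brings the highest root below 1.
  refine ⟨(1 + |t|)⁻¹ • x, fun i hi => ?_, ?_⟩
  · have := hx ⟨i, hi⟩
    rw [b.toWeightBasis_apply] at this
    rw [inner_smul_right, this]
    positivity
  · rw [inner_smul_right, inv_mul_lt_iff₀ ht, mul_one]
    exact (le_abs_self t).trans_lt (by simp)

/-- Points of the open alcove pair with positive roots strictly between `0` and `1`. -/
lemma inner_root_pos_of_isPos {b : Φ.Base} {ξ : ι} {ρ : V} (hρ : ρ ∈ openAlcove b ξ) {i : ι}
    (hi : b.IsPos i) : 0 < inner ℝ (Φ.root i) ρ := by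
  obtain ⟨f, hf₀, hf₁, hf₂⟩ := b.exists_root_eq_sum_int i
  have hpos : 0 < f := by
    refine hf₁.resolve_right fun h => ?_
    rw [RootPairing.Base.isPos_iff, RootPairing.Base.height_eq_sum hf₂] at hi
    exact absurd hi (not_lt.mpr (Finset.sum_nonpos fun i _ => h.le i))
  rw [hf₂, sum_inner]
  obtain ⟨j, hj⟩ : ∃ j, 0 < f j := by
    by_contra! h
    exact hpos.not_ge h
  have hjs : j ∈ b.support := hf₀ (by simpa using hj.ne')
  refine Finset.sum_pos' (fun k hk => ?_) ⟨j, hjs, ?_⟩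
  · rw [← Int.cast_smul_eq_zsmul ℝ, real_inner_smul_left]
    exact mul_nonneg (by exact_mod_cast hpos.le k) (hρ.1 k hk).le
  · rw [← Int.cast_smul_eq_zsmul ℝ, real_inner_smul_left]
    exact mul_pos (by exact_mod_cast hj) (hρ.1 j hjs)

lemma inner_root_lt_one {b : Φ.Base} {ξ : ι} (hξ : IsHighestRoot b ξ) {ρ : V}
    (hρ : ρ ∈ openAlcove b ξ) (i : ι) : inner ℝ (Φ.root i) ρ < 1 := by
  have := inner_nonneg_of_mem_closure (fun i hi => (hρ.1 i hi).le) (hξ i)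
  rw [inner_sub_left] at this
  linarith [hρ.2]

lemma root_reflectionPerm_self (Φ : RootPairing ι ℝ V V) (i : ι) :
    Φ.root (Φ.reflectionPerm i i) = -Φ.root i := by simp

lemma coroot_reflectionPerm_self (Φ : RootPairing ι ℝ V V) (i : ι) :
    Φ.coroot (Φ.reflectionPerm i i) = -Φ.coroot i := by simp

lemma neg_one_lt_inner_root {b : Φ.Base} {ξ : ι} (hξ : IsHighestRoot b ξ) {ρ : V}
    (hρ : ρ ∈ openAlcove b ξ) (i : ι) : -1 < inner ℝ (Φ.root i) ρ := by
  have := inner_root_lt_one hξ hρ (Φ.reflectionPerm i i)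
  rw [root_reflectionPerm_self, inner_neg_left] at this
  linarith

lemma isPos_iff_inner_pos {b : Φ.Base} {ξ : ι} {ρ : V} (hρ : ρ ∈ openAlcove b ξ) {i : ι} :
    b.IsPos i ↔ 0 < inner ℝ (Φ.root i) ρ := by
  refine ⟨inner_root_pos_of_isPos hρ, fun h => ?_⟩
  rcases RootPairing.Base.IsPos.or_neg b i with hi | hi
  · exact hi
  · have := inner_root_pos_of_isPos hρ hi
    change 0 < inner ℝ (Φ.root (Φ.reflectionPerm i i)) ρ at this
    rw [root_reflectionPerm_self, inner_neg_left] at this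
    linarith

lemma inner_root_ne_zero {b : Φ.Base} {ξ : ι} {ρ : V} (hρ : ρ ∈ openAlcove b ξ) (i : ι) :
    inner ℝ (Φ.root i) ρ ≠ 0 := by
  rcases RootPairing.Base.IsPos.or_neg b i with hi | hi
  · exact (inner_root_pos_of_isPos hρ hi).ne'
  · have := inner_root_pos_of_isPos hρ hi
    change 0 < inner ℝ (Φ.root (Φ.reflectionPerm i i)) ρ at this
    rw [root_reflectionPerm_self, inner_neg_left] at this
    linarith

/-! ### The highest root is long -/

/-- The difference ξ - r_i ξ = ⟨α_i, ξ⟩ α_i^∨ is a non-negative combination of simple roots, so its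
pairing with an interior point fixes the sign of the coefficient. -/
lemma inner_root_highest_nonneg (hΦ : IsEuclidean Φ) [Φ.IsRootSystem] {b : Φ.Base} {ξ : ι}
    (hξ : IsHighestRoot b ξ) {i : ι} (hi : i ∈ b.support) :
    0 ≤ inner ℝ (Φ.root i) (Φ.root ξ) := by
  obtain ⟨ρ, hρ⟩ := openAlcove_nonempty b ξ
  have h := inner_nonneg_of_mem_closure (fun i hi => (hρ.1 i hi).le) (hξ (Φ.reflectionPerm i ξ))
  rw [Φ.root_reflectionPerm, ← hΦ.coreflection_eq_reflection, hΦ.coreflection_apply,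
    sub_sub_cancel, hΦ.coroot_eq, smul_smul, real_inner_smul_left] at h
  have h1 := inner_root_self_pos Φ i
  have h2 : 0 < 2 / inner ℝ (Φ.root i) (Φ.root i) * inner ℝ (Φ.root i) ρ :=
    mul_pos (div_pos two_pos h1) (hρ.1 i hi)
  rw [mul_assoc] at h
  exact nonneg_of_mul_nonneg_left h h2

/-- Among roots of the given length, one that is maximal on an interior point is dominant; call it
β. Then ξ + β is dominant and ξ - β is a non-negative combination of simple roots, so 0 ≤ ⟨ξ - β, ξ
+ β⟩ = |ξ|² - |β|². -/
lemma inner_root_self_le_highest (hΦ : IsEuclidean Φ) [Finite ι] [Φ.IsRootSystem] {b : Φ.Base}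
    {ξ : ι} (hξ : IsHighestRoot b ξ) (i : ι) :
    inner ℝ (Φ.root i) (Φ.root i) ≤ inner ℝ (Φ.root ξ) (Φ.root ξ) := by
  obtain ⟨ρ, hρ⟩ := openAlcove_nonempty b ξ
  obtain ⟨j, hj, hmax⟩ := Set.exists_max_image
    {j : ι | inner ℝ (Φ.root j) (Φ.root j) = inner ℝ (Φ.root i) (Φ.root i)}
    (fun j => inner ℝ (Φ.root j) ρ) (Set.toFinite _) ⟨i, rfl⟩
  have hdom : ∀ k ∈ b.support, 0 ≤ inner ℝ (Φ.root k) (Φ.root j) := by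
    intro k hk
    have h := hmax (Φ.reflectionPerm k j) (by
      change _ = _
      rw [Φ.root_reflectionPerm, ← hΦ.coreflection_eq_reflection, hΦ.inner_coreflection]
      exact hj)
    rw [Φ.root_reflectionPerm, ← hΦ.coreflection_eq_reflection, hΦ.coreflection_apply,
      hΦ.coroot_eq, smul_smul, inner_sub_left, real_inner_smul_left] at h
    have h2 : 0 < 2 / inner ℝ (Φ.root k) (Φ.root k) * inner ℝ (Φ.root k) ρ :=
      mul_pos (div_pos two_pos (inner_root_self_pos Φ k)) (hρ.1 k hk)
    exact nonneg_of_mul_nonneg_left (by linarith : 0 ≤ inner ℝ (Φ.root k) (Φ.root j) * _) h2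
  have h := inner_nonneg_of_mem_closure (a := Φ.root ξ + Φ.root j) (fun k hk => by
    rw [inner_add_right]
    exact add_nonneg (inner_root_highest_nonneg hΦ hξ hk) (hdom k hk)) (hξ j)
  rw [inner_sub_left, inner_add_right, inner_add_right, real_inner_comm (Φ.root ξ) (Φ.root j)] at h
  have hj' : inner ℝ (Φ.root j) (Φ.root j) = inner ℝ (Φ.root i) (Φ.root i) := hj
  linarith

/-- A root of maximal length pairs with any other root to `0` or `±1`, unless they are equal up to
sign. -/
lemma inner_root_eq_of_long (hΦ : IsEuclidean Φ) [Φ.IsCrystallographic] {γ i : ι}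
    (hγ : inner ℝ (Φ.root γ) (Φ.root γ) = 2) (hi : inner ℝ (Φ.root i) (Φ.root i) ≤ 2) :
    Φ.root i = Φ.root γ ∨ Φ.root i = -Φ.root γ ∨
      ∃ k : ℤ, inner ℝ (Φ.root i) (Φ.root γ) = k ∧ -1 ≤ k ∧ k ≤ 1 := by
  have hk : inner ℝ (Φ.root i) (Φ.root γ) = (Φ.pairingIn ℤ i γ : ℝ) := by
    have h1 : (Φ.pairingIn ℤ i γ : ℝ) = Φ.pairing i γ := Φ.algebraMap_pairingIn ℤ i γ
    rw [h1, ← hΦ.inner_root_coroot, hΦ.coroot_eq, hγ]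
    simp
  set k := Φ.pairingIn ℤ i γ
  -- Equality in Cauchy–Schwarz: a pairing of at least 2 between vectors of squared length at most 2
  -- makes the square of their difference non-positive.
  by_cases h1 : (2 : ℤ) ≤ k
  · left
    have h1' : (2 : ℝ) ≤ k := by exact_mod_cast h1
    rw [← sub_eq_zero, ← inner_self_eq_zero (𝕜 := ℝ)]
    refine le_antisymm ?_ real_inner_self_nonneg
    rw [inner_sub_left, inner_sub_right, inner_sub_right, real_inner_comm (Φ.root i) (Φ.root γ)]
    linarith
  by_cases h2 : k ≤ -2
  · right; left
    have h2' : (k : ℝ) ≤ -2 := by exact_mod_cast h2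
    rw [← sub_eq_zero, ← inner_self_eq_zero (𝕜 := ℝ)]
    refine le_antisymm ?_ real_inner_self_nonneg
    rw [sub_neg_eq_add, inner_add_left, inner_add_right, inner_add_right,
      real_inner_comm (Φ.root i) (Φ.root γ)]
    linarith
  · exact Or.inr (Or.inr ⟨k, hk, by lia, by lia⟩)

/-- Every root is, up to sign, a Weyl conjugate of the highest root or pairs to `±1` with one. -/
lemma exists_conj_highest (hΦ : IsEuclidean Φ) [Finite ι] [Φ.IsRootSystem] [Φ.IsCrystallographic]
    [Φ.IsReduced] [Φ.IsIrreducible] {b : Φ.Base} {ξ : ι} (hξ : IsHighestRoot b ξ)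
    (hnorm : inner ℝ (Φ.root ξ) (Φ.root ξ) = 2) (i : ι) :
    ∃ w ∈ weylGroup b, ∃ γ, w (Φ.root ξ) = Φ.root γ ∧ w (Φ.coroot ξ) = Φ.coroot γ ∧
      inner ℝ (Φ.root γ) (Φ.root γ) = 2 ∧ (Φ.root i = Φ.root γ ∨ Φ.root i = -Φ.root γ ∨
        inner ℝ (Φ.root i) (Φ.root γ) = 1 ∨ inner ℝ (Φ.root i) (Φ.root γ) = -1) := by
  obtain ⟨w, hw, hne⟩ : ∃ w ∈ weylGroup b, inner ℝ (Φ.root i) (w (Φ.root ξ)) ≠ 0 := by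
    by_contra! h
    -- The orbit of ξ spans a nonzero W-invariant subspace, hence all of V by irreducibility, so no
    -- root is orthogonal to the whole orbit.
    let q : Submodule ℝ V := Submodule.span ℝ {x | ∃ w ∈ weylGroup b, x = w (Φ.root ξ)}
    have hq : q = ⊤ := by
      refine RootPairing.IsIrreducible.eq_top_of_invtSubmodule_coreflection (P := Φ) q
        (fun j => ?_) ?_
      · rw [Module.End.mem_invtSubmodule]
        refine Submodule.span_le.mpr ?_
        rintro _ ⟨w, hw, rfl⟩
        exact Submodule.subset_span
          ⟨_, mul_mem (coreflection_mem_weylGroup b j) hw, (LinearEquiv.mul_apply _ _ _).symm⟩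
      · intro h0
        have : Φ.root ξ ∈ q := Submodule.subset_span ⟨1, one_mem _, rfl⟩
        rw [h0, Submodule.mem_bot] at this
        exact Φ.ne_zero ξ this
    have hle : q ≤ LinearMap.ker (innerₗ V (Φ.root i)) := by
      refine Submodule.span_le.mpr ?_
      rintro _ ⟨w, hw, rfl⟩
      exact h w hw
    have : Φ.root i ∈ LinearMap.ker (innerₗ V (Φ.root i)) := hle (hq ▸ Submodule.mem_top)
    exact (inner_root_self_pos Φ i).ne' this
  obtain ⟨γ, hγ, hγ'⟩ := weylGroup_map_root hΦ hw ξ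
  have hγ2 : inner ℝ (Φ.root γ) (Φ.root γ) = 2 := by rw [← hγ, weylGroup_inner hΦ hw, hnorm]
  refine ⟨w, hw, γ, hγ, hγ', hγ2, ?_⟩
  rcases inner_root_eq_of_long hΦ hγ2 (hnorm ▸ inner_root_self_le_highest hΦ hξ i) with
    h | h | ⟨k, hk, h1, h2⟩
  · exact Or.inl h
  · exact Or.inr (Or.inl h)
  · right; right
    have hk0 : k ≠ 0 := by
      rintro rfl
      exact hne (by rw [hγ, hk]; simp)
    obtain rfl | rfl : k = 1 ∨ k = -1 := by lia
    · left; simpa using hk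
    · right; simpa using hk

/-- With long roots of squared length two, the coroot lattice lies in the weight lattice. -/
lemma corootLattice_le_weightLattice (hΦ : IsEuclidean Φ) [Finite ι] [Φ.IsRootSystem]
    [Φ.IsCrystallographic] [Φ.IsReduced] [Φ.IsIrreducible] {b : Φ.Base} {ξ : ι}
    (hξ : IsHighestRoot b ξ) (hnorm : inner ℝ (Φ.root ξ) (Φ.root ξ) = 2) :
    corootLattice b ≤ weightLattice b := by
  refine (AddSubgroup.closure_le _).mpr ?_
  rintro _ ⟨i, -, rfl⟩
  obtain ⟨w, hw, γ, hγ, -, hγ2, h⟩ := exists_conj_highest hΦ hξ hnorm i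
  have hlong : inner ℝ (Φ.root i) (Φ.root i) = 2 → Φ.coroot i ∈ weightLattice b := fun h2 => by
    rw [hΦ.coroot_eq, h2, div_self two_ne_zero, one_smul]
    exact root_mem_weightLattice hΦ b i
  -- If ⟨α_i, γ⟩ = e = ±1, integrality of the pairing of γ with α_i^∨ makes 2/⟨α_i, α_i⟩ an integer,
  -- so α_i^∨ is an integer multiple of α_i.
  have hshort : ∀ e : ℤ, e * e = 1 → inner ℝ (Φ.root i) (Φ.root γ) = e →
      Φ.coroot i ∈ weightLattice b := fun e he h1 => by
    have he' : (e : ℝ) * e = 1 := by exact_mod_cast he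
    have hp : (Φ.pairingIn ℤ γ i : ℝ) = 2 / inner ℝ (Φ.root i) (Φ.root i) * e := by
      have h1' : (Φ.pairingIn ℤ γ i : ℝ) = Φ.pairing γ i := Φ.algebraMap_pairingIn ℤ γ i
      rw [h1', ← hΦ.inner_root_coroot, hΦ.inner_coroot_right, h1]
    have hc : Φ.coroot i = (Φ.pairingIn ℤ γ i * e) • Φ.root i := by
      rw [hΦ.coroot_eq, ← Int.cast_smul_eq_zsmul ℝ]
      push_cast
      rw [hp, mul_assoc, he', mul_one]
    rw [hc]
    exact zsmul_mem (root_mem_weightLattice hΦ b i) _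
  rcases h with h | h | h | h
  · exact hlong (by rw [h, hγ2])
  · exact hlong (by rw [h, inner_neg_neg, hγ2])
  · exact hshort 1 rfl (by simpa using h)
  · exact hshort (-1) rfl (by simpa using h)

/-- The coroot lattice is spanned by the Weyl orbit of the highest coroot. -/
lemma corootLattice_le_closure_conj_highest (hΦ : IsEuclidean Φ) [Finite ι] [Φ.IsRootSystem]
    [Φ.IsCrystallographic] [Φ.IsReduced] [Φ.IsIrreducible] {b : Φ.Base} {ξ : ι}
    (hξ : IsHighestRoot b ξ) (hnorm : inner ℝ (Φ.root ξ) (Φ.root ξ) = 2) :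
    corootLattice b ≤ AddSubgroup.closure {x | ∃ w ∈ weylGroup b, x = w (Φ.coroot ξ)} := by
  refine (AddSubgroup.closure_le _).mpr ?_
  rintro _ ⟨i, -, rfl⟩
  obtain ⟨w, hw, γ, hγ, hγ', hγ2, h⟩ := exists_conj_highest hΦ hξ hnorm i
  have hmem : Φ.coroot γ ∈ AddSubgroup.closure {x | ∃ w ∈ weylGroup b, x = w (Φ.coroot ξ)} :=
    AddSubgroup.subset_closure ⟨w, hw, hγ'.symm⟩
  -- This is the reflection of γ^∨ in α_i, again in the orbit; when ⟨α_i, γ⟩ = ±1 it differs from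
  -- γ^∨ by ±α_i^∨.
  have hmem' : Φ.coroot γ - inner ℝ (Φ.root i) (Φ.root γ) • Φ.coroot i ∈
      AddSubgroup.closure {x | ∃ w ∈ weylGroup b, x = w (Φ.coroot ξ)} := by
    refine AddSubgroup.subset_closure
      ⟨_, mul_mem (coreflection_mem_weylGroup b i) hw, ?_⟩
    rw [LinearEquiv.mul_apply, hγ', hΦ.coreflection_apply, hΦ.coroot_eq γ, hγ2]
    simp
  rcases h with h | h | h | h
  · rw [Φ.root.injective h]; exact hmem
  · have h' : Φ.coroot i = -Φ.coroot γ := by rw [hΦ.coroot_eq, hΦ.coroot_eq, h]; simp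
    rw [h']; exact neg_mem hmem
  · rw [h] at hmem'
    simpa using sub_mem hmem hmem'
  · rw [h] at hmem'
    simpa using sub_mem hmem' hmem

/-! ### Affine roots and affine reflections -/

/-- The affine root `x ↦ ⟨α, x⟩ + k`. -/
noncomputable def affineForm (Φ : RootPairing ι ℝ V V) (p : ι × ℤ) (x : V) : ℝ :=
  inner ℝ (Φ.root p.1) x + p.2

/-- The reflection in the zero set of an affine root. -/
def affineReflection (Φ : RootPairing ι ℝ V V) (p : ι × ℤ) : V ≃ᵃ[ℝ] V :=
  (Φ.coreflection p.1).toAffineEquiv.trans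
    (AffineEquiv.constVAdd ℝ V (-(p.2 : ℝ) • Φ.coroot p.1))

/-- The indices of the simple affine roots, whose zero sets are the walls of the fundamental
domain. -/
def simpleAffine (b : Φ.Base) (ξ : ι) : Set (ι × ℤ) :=
  -- `Φ.reflectionPerm ξ ξ` indexes -ξ, so the last simple affine root is 1 - ⟨ξ, x⟩.
  {p | (p.1 ∈ b.support ∧ p.2 = 0) ∨ p = (Φ.reflectionPerm ξ ξ, 1)}

lemma affineReflection_apply (hΦ : IsEuclidean Φ) (p : ι × ℤ) (x : V) :
    affineReflection Φ p x = x - affineForm Φ p x • Φ.coroot p.1 := by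
  change -(p.2 : ℝ) • Φ.coroot p.1 + Φ.coreflection p.1 x = _
  rw [hΦ.coreflection_apply, affineForm]
  module

lemma affineReflection_linear (Φ : RootPairing ι ℝ V V) (p : ι × ℤ) :
    (affineReflection Φ p).linear = Φ.coreflection p.1 := by
  rfl

lemma affineForm_affineReflection (hΦ : IsEuclidean Φ) (p : ι × ℤ) (x : V) :
    affineForm Φ p (affineReflection Φ p x) = -affineForm Φ p x := by
  rw [affineReflection_apply hΦ, affineForm, inner_sub_right, inner_smul_right,
    hΦ.inner_root_coroot, Φ.pairing_same, affineForm]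
  ring

lemma affineReflection_mul_self (hΦ : IsEuclidean Φ) (p : ι × ℤ) :
    affineReflection Φ p * affineReflection Φ p = 1 := by
  ext x
  change affineReflection Φ p (affineReflection Φ p x) = x
  rw [affineReflection_apply hΦ, affineForm_affineReflection hΦ, affineReflection_apply hΦ]
  module

lemma affineReflection_mem [Finite ι] [Φ.IsCrystallographic] [Φ.IsReduced] (b : Φ.Base)
    (p : ι × ℤ) : affineReflection Φ p ∈ affineWeylGroup b := by
  refine ⟨?_, ?_⟩
  · rw [affineReflection_linear]
    exact coreflection_mem_weylGroup b p.1
  · change -(p.2 : ℝ) • Φ.coroot p.1 + Φ.coreflection p.1 0 ∈ _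
    rw [map_zero, add_zero, ← Int.cast_neg, Int.cast_smul_eq_zsmul]
    exact zsmul_mem (coroot_mem_corootLattice b p.1) _

lemma affineEquiv_apply_eq (g : V ≃ᵃ[ℝ] V) (x : V) : g x = g.linear x + g 0 := by
  simpa using g.map_vadd 0 x

/-- Affine roots and their reflections are permuted by the affine Weyl group. -/
lemma exists_affineForm_comp (hΦ : IsEuclidean Φ) [Φ.IsCrystallographic] {b : Φ.Base}
    {g : V ≃ᵃ[ℝ] V} (hg : g ∈ affineWeylGroup b) (p : ι × ℤ) :
    ∃ q : ι × ℤ, (∀ x, affineForm Φ p (g x) = affineForm Φ q x) ∧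
      affineReflection Φ p * g = g * affineReflection Φ q := by
  obtain ⟨j, hj, hj'⟩ := weylGroup_map_root hΦ (inv_mem hg.1) p.1
  obtain ⟨k, hk⟩ := exists_inner_root_eq_int hΦ p.1 hg.2
  have hform : ∀ x, affineForm Φ p (g x) = affineForm Φ (j, k + p.2) x := fun x => by
    rw [affineForm, affineForm, affineEquiv_apply_eq, inner_add_right, hk, ← hj,
      weylGroup_inner_left hΦ (inv_mem hg.1), inv_inv]
    push_cast
    ring
  refine ⟨(j, k + p.2), hform, ?_⟩
  have hw : g.linear (Φ.coroot j) = Φ.coroot p.1 := by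
    rw [← hj', ← LinearEquiv.mul_apply, mul_inv_cancel]; rfl
  ext x
  change affineReflection Φ p (g x) = g (affineReflection Φ (j, k + p.2) x)
  rw [affineReflection_apply hΦ, affineReflection_apply hΦ, hform, affineEquiv_apply_eq g (_ - _),
    map_sub, map_smul, hw, affineEquiv_apply_eq g x]
  abel

lemma mem_fundamentalDomain_iff {b : Φ.Base} {ξ : ι} {a : V} :
    a ∈ fundamentalDomain b ξ ↔ ∀ p ∈ simpleAffine b ξ, 0 ≤ affineForm Φ p a := by
  constructor
  · rintro ⟨h1, h2⟩ ⟨i, k⟩ (⟨hi, rfl⟩ | h)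
    · simpa [affineForm] using h1 i hi
    · rw [h, affineForm, root_reflectionPerm_self, inner_neg_left]
      push_cast
      linarith
  · intro h
    refine ⟨fun i hi => by simpa [affineForm] using h (i, 0) (Or.inl ⟨hi, rfl⟩), ?_⟩
    have := h _ (Or.inr rfl)
    rw [affineForm, root_reflectionPerm_self, inner_neg_left] at this
    push_cast at this
    linarith

lemma affineForm_pos {b : Φ.Base} {ξ : ι} {ρ : V} (hρ : ρ ∈ openAlcove b ξ) {p : ι × ℤ}
    (hp : p ∈ simpleAffine b ξ) : 0 < affineForm Φ p ρ := by
  obtain ⟨i, k⟩ := p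
  obtain ⟨hi, rfl⟩ | h := hp
  · simpa [affineForm] using hρ.1 i hi
  · rw [h, affineForm, root_reflectionPerm_self, inner_neg_left]
    push_cast
    linarith [hρ.2]

/-- On the open alcove a root takes a nonzero value of absolute value below 1, which no integer
level can cancel. -/
lemma affineForm_ne_zero {b : Φ.Base} {ξ : ι} (hξ : IsHighestRoot b ξ) {ρ : V}
    (hρ : ρ ∈ openAlcove b ξ) (p : ι × ℤ) : affineForm Φ p ρ ≠ 0 := by
  intro h
  rw [affineForm] at h
  have h1 := inner_root_lt_one hξ hρ p.1
  have h2 := neg_one_lt_inner_root hξ hρ p.1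
  have h3 : (-1 : ℝ) < p.2 := by linarith
  have h4 : (p.2 : ℝ) < 1 := by linarith
  have h5 : -1 < p.2 := by exact_mod_cast h3
  have h6 : p.2 < 1 := by exact_mod_cast h4
  have h7 : p.2 = 0 := by lia
  rw [h7] at h
  exact inner_root_ne_zero hρ p.1 (by simpa using h)

/-- The only affine root hyperplane separating the open alcove from its image under a simple
affine reflection is the wall of that reflection. -/
lemma eq_of_separates (hΦ : IsEuclidean Φ) [Finite ι] [Φ.IsRootSystem] [Φ.IsCrystallographic]
    [Φ.IsReduced] {b : Φ.Base} {ξ : ι} (hξ : IsHighestRoot b ξ)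
    (hnorm : inner ℝ (Φ.root ξ) (Φ.root ξ) = 2) {ρ : V} (hρ : ρ ∈ openAlcove b ξ) {p q : ι × ℤ}
    (hp : p ∈ simpleAffine b ξ) (h₁ : 0 < affineForm Φ q ρ)
    (h₂ : affineForm Φ q (affineReflection Φ p ρ) < 0) : q = p := by
  obtain ⟨j, l⟩ := q
  have hl : -1 < l := by
    have h := inner_root_lt_one hξ hρ j
    rw [affineForm] at h₁
    exact_mod_cast (by push_cast; linarith : ((-1 : ℤ) : ℝ) < l)
  obtain ⟨i, k⟩ := p
  obtain ⟨hi, hk⟩ | h := hp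
  · simp only at hi hk
    subst hk
    have hrefl : affineForm Φ (j, l) (affineReflection Φ (i, 0) ρ) =
        inner ℝ (Φ.root (Φ.reflectionPerm i j)) ρ + l := by
      rw [Φ.root_reflectionPerm, ← hΦ.coreflection_eq_reflection, affineForm]
      simp only [affineReflection_apply hΦ, affineForm, hΦ.coreflection_apply, Int.cast_zero,
        add_zero, inner_sub_left, inner_sub_right, inner_smul_left, inner_smul_right, hΦ.coroot_eq,
        conj_trivial, real_inner_comm (Φ.root i) (Φ.root j)]
      ring
    rw [hrefl] at h₂
    have h := neg_one_lt_inner_root hξ hρ (Φ.reflectionPerm i j)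
    -- Values of roots at ρ lie in (-1, 1), so the sign change forces level 0. The root j is then
    -- positive with negative image under a simple reflection, which happens only for the reflecting
    -- root itself.
    have hl' : l < 1 := by exact_mod_cast (by linarith : (l : ℝ) < 1)
    obtain rfl : l = 0 := by lia
    have hj : b.IsPos j := (isPos_iff_inner_pos hρ).mpr (by simpa [affineForm] using h₁)
    by_contra hne
    have := inner_root_pos_of_isPos hρ (hj.reflectionPerm hi fun h => hne (by rw [h]))
    simp only [Int.cast_zero, add_zero] at h₂
    linarith
  · rw [h] at h₂ ⊢
    have hcr : Φ.coroot ξ = Φ.root ξ := by rw [hΦ.coroot_eq, hnorm]; simp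
    have hval : affineForm Φ (j, l) (affineReflection Φ (Φ.reflectionPerm ξ ξ, 1) ρ) =
        inner ℝ (Φ.root j) ρ + l + (1 - inner ℝ (Φ.root ξ) ρ) * inner ℝ (Φ.root j) (Φ.root ξ) := by
      simp only [affineReflection_apply hΦ, affineForm, root_reflectionPerm_self,
        coroot_reflectionPerm_self, hcr, inner_sub_right, inner_smul_right, inner_neg_left,
        inner_neg_right, Int.cast_one]
      ring
    rw [hval] at h₂
    rw [affineForm] at h₁
    simp only at h₁
    have hlow := neg_one_lt_inner_root hξ hρ j
    have hξ1 := hρ.2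
    have hξpos : 0 < inner ℝ (Φ.root ξ) ρ := by
      have h0 := inner_nonneg_of_mem_closure (fun i hi => (hρ.1 i hi).le) (hξ (Φ.reflectionPerm ξ ξ))
      rw [root_reflectionPerm_self, inner_sub_left, inner_neg_left] at h0
      exact lt_of_le_of_ne (by linarith) (inner_root_ne_zero hρ ξ).symm
    have hl0 : (0 : ℝ) ≤ l := by exact_mod_cast (by lia : 0 ≤ l)
    -- The reflection adds (1 - ⟨ξ, ρ⟩) ξ to ρ, so the form changes by a positive multiple of ⟨α_j,
    -- ξ⟩. As ξ is long, only -ξ and the pairings -1, 0, 1 remain once ξ itself is excluded.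
    rcases inner_root_eq_of_long hΦ hnorm (hnorm ▸ inner_root_self_le_highest hΦ hξ j) with
      h3 | h3 | ⟨m, hm, hm1, hm2⟩
    · rw [h3, hnorm] at h₂
      rw [h3] at h₁
      nlinarith
    · rw [h3, inner_neg_left, inner_neg_left, hnorm] at h₂
      rw [h3, inner_neg_left] at h₁
      have h4 : (0 : ℝ) < l := by linarith
      have h5 : (l : ℝ) < 2 := by linarith
      have h6 : 0 < l := by exact_mod_cast h4
      have h7 : l < 2 := by exact_mod_cast h5
      obtain rfl : l = 1 := by lia
      rw [Φ.root_eq_neg_iff.mp h3]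
    · exfalso
      rw [hm] at h₂
      obtain rfl | rfl | rfl : m = -1 ∨ m = 0 ∨ m = 1 := by lia
      · push_cast at h₂
        have h0 := inner_nonneg_of_mem_closure (fun i hi => (hρ.1 i hi).le)
          (hξ (Φ.reflectionPerm j j))
        rw [root_reflectionPerm_self, inner_sub_left, inner_neg_left] at h0
        have h4 : (l : ℝ) < 1 := by linarith
        have h6 : l < 1 := by exact_mod_cast h4
        obtain rfl : l = 0 := by lia
        -- At level 0, positivity at ρ makes α_j a positive root, so dominance of ξ contradicts the
        -- pairing -1.
        have hξdom : (0 : ℝ) ≤ inner ℝ (Φ.root j) (Φ.root ξ) := by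
          rcases b.root_mem_or_neg_mem j with hj' | hj'
          · exact inner_nonneg_of_mem_closure (fun i hi => inner_root_highest_nonneg hΦ hξ hi) hj'
          · have := inner_nonneg_of_mem_closure (fun i hi => (hρ.1 i hi).le) hj'
            rw [inner_neg_left] at this
            push_cast at h₁
            linarith
        rw [hm] at hξdom
        norm_num at hξdom
      · push_cast at h₂
        linarith
      · push_cast at h₂
        linarith

/-! ### Words in involutions -/

/-- If the product of a word in involutions leaves the set `P`, and every single step leaving `P`
amounts to left multiplication by `s`, then multiplying by `s` on the left shortens the word. -/
lemma exists_shorter_word {G : Type*} [Group G] {S : Set G} (hS : ∀ t ∈ S, t * t = 1) {s : G}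
    {P : Set G} (h1 : 1 ∈ P)
    (hP : ∀ l : List G, (∀ t ∈ l, t ∈ S) → ∀ t ∈ S, l.prod ∈ P → l.prod * t ∉ P →
      s * l.prod = l.prod * t)
    (l : List G) (hl : ∀ t ∈ l, t ∈ S) (hlP : l.prod ∉ P) :
    ∃ l' : List G, (∀ t ∈ l', t ∈ S) ∧ l'.length < l.length ∧ l'.prod = s * l.prod := by
  induction l using List.reverseRecOn with
  | nil => exact absurd (by simpa using h1) hlP
  | append_singleton l t ih =>
    have hl0 : ∀ u ∈ l, u ∈ S := fun u hu => hl u (by simp [hu])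
    have ht : t ∈ S := hl t (by simp)
    rw [List.prod_append, List.prod_singleton] at hlP ⊢
    by_cases h : l.prod ∈ P
    -- The letter `t` crosses out of `P`: from s·l = l·t and t² = 1 one gets s·l·t = l, so `t` is
    -- deleted.
    · refine ⟨l, hl0, by simp, ?_⟩
      rw [← mul_assoc, hP l hl0 t ht h hlP, mul_assoc, hS t ht, mul_one]
    · obtain ⟨l', h1, h2, h3⟩ := ih hl0 h
      refine ⟨l' ++ [t], ?_, by simpa using h2, by simp [h3, mul_assoc]⟩
      intro u hu
      rcases List.mem_append.mp hu with hu | hu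
      · exact h1 u hu
      · rw [List.mem_singleton.mp hu]; exact ht

/-! ### The fundamental domain of the affine Weyl group -/

lemma segment_mem_openAlcove {b : Φ.Base} {ξ : ι} {a ρ : V} (ha : a ∈ fundamentalDomain b ξ)
    (hρ : ρ ∈ openAlcove b ξ) {t : ℝ} (ht0 : 0 < t) (ht1 : t ≤ 1) :
    a + t • (ρ - a) ∈ openAlcove b ξ := by
  have key : ∀ x : V, inner ℝ x (a + t • (ρ - a)) = (1 - t) * inner ℝ x a + t * inner ℝ x ρ :=
    fun x => by
      rw [inner_add_right, inner_smul_right, inner_sub_right]; ring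
  refine ⟨fun i hi => ?_, ?_⟩
  · rw [key]
    have := mul_nonneg (sub_nonneg.mpr ht1) (ha.1 i hi)
    have := mul_pos ht0 (hρ.1 i hi)
    linarith
  · rw [key]
    have := mul_le_mul_of_nonneg_left ha.2 (sub_nonneg.mpr ht1)
    have := mul_lt_mul_of_pos_left hρ.2 ht0
    linarith

/-- A word in the simple affine reflections mapping a point of the fundamental domain into the
fundamental domain fixes it. -/
lemma prod_apply_eq_self (hΦ : IsEuclidean Φ) [Finite ι] [Φ.IsRootSystem] [Φ.IsCrystallographic]
    [Φ.IsReduced] {b : Φ.Base} {ξ : ι} (hξ : IsHighestRoot b ξ)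
    (hnorm : inner ℝ (Φ.root ξ) (Φ.root ξ) = 2) {a : V} (ha : a ∈ fundamentalDomain b ξ) (n : ℕ)
    (l : List (V ≃ᵃ[ℝ] V)) (hn : l.length = n)
    (hl : ∀ g ∈ l, g ∈ affineReflection Φ '' simpleAffine b ξ)
    (hla : l.prod a ∈ fundamentalDomain b ξ) : l.prod a = a := by
  induction n using Nat.strong_induction_on generalizing l with
  | _ n ih =>
  cases l with
  | nil => rfl
  | cons s l =>
    have hl0 : ∀ g ∈ l, g ∈ affineReflection Φ '' simpleAffine b ξ := fun g hg =>
      hl g (List.mem_cons_of_mem _ hg)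
    obtain ⟨p, hp, rfl⟩ := hl s List.mem_cons_self
    have hgrp : ∀ l : List (V ≃ᵃ[ℝ] V), (∀ g ∈ l, g ∈ affineReflection Φ '' simpleAffine b ξ) →
        l.prod ∈ affineWeylGroup b := fun l hl => list_prod_mem fun g hg => by
      obtain ⟨q, -, rfl⟩ := hl g hg
      exact affineReflection_mem b q
    rw [List.prod_cons] at hla ⊢
    -- If the word sends the whole open alcove to the non-positive side of wall `p`, then by
    -- continuity its image of a lies on that wall and the first letter can be dropped. Otherwise
    -- some ρ is sent to the negative side by the tail, and the exchange argument gives a shorter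
    -- word for the same element.
    by_cases hneg : ∀ ρ ∈ openAlcove b ξ,
        affineForm Φ p ((affineReflection Φ p * l.prod) ρ) ≤ 0
    · have hle : affineForm Φ p ((affineReflection Φ p * l.prod) a) ≤ 0 := by
        obtain ⟨ρ, hρ⟩ := openAlcove_nonempty b ξ
        obtain ⟨q, hq, -⟩ := exists_affineForm_comp hΦ
          (mul_mem (affineReflection_mem b p) (hgrp l hl0)) p
        rw [hq]
        by_contra! hpos
        set c := affineForm Φ q a
        set d := affineForm Φ q ρ
        have hcd : ∀ t : ℝ, affineForm Φ q (a + t • (ρ - a)) = c + t * (d - c) := fun t => by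
          simp only [c, d, affineForm, inner_add_right, inner_smul_right, inner_sub_right]; ring
        have hd : d ≤ 0 := (hq ρ).symm.trans_le (hneg ρ hρ)
        have hcd0 : 0 < c - d := by linarith
        -- At this parameter the affine form on the segment from a to ρ equals c/2, still positive.
        have ht0 : 0 < c / (2 * (c - d)) := by positivity
        have ht1 : c / (2 * (c - d)) ≤ 1 := by
          rw [div_le_one (by positivity)]; linarith
        have := hneg _ (segment_mem_openAlcove ha hρ ht0 ht1)
        rw [hq, hcd] at this
        have h2 : c / (2 * (c - d)) * (d - c) = -c / 2 := by
          field_simp; ring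
        linarith
      have hz : affineForm Φ p ((affineReflection Φ p * l.prod) a) = 0 :=
        le_antisymm hle (mem_fundamentalDomain_iff.mp hla p hp)
      have hfix : l.prod a = (affineReflection Φ p * l.prod) a := by
        have h1 : (affineReflection Φ p * (affineReflection Φ p * l.prod)) a = l.prod a := by
          rw [← mul_assoc, affineReflection_mul_self hΦ, one_mul]
        rw [← h1]
        change affineReflection Φ p ((affineReflection Φ p * l.prod) a) = _
        rw [affineReflection_apply hΦ, hz, zero_smul, sub_zero]
      rw [← hfix] at hla ⊢
      exact ih l.length (by simp [← hn]) l rfl hl0 hla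
    · push Not at hneg
      obtain ⟨ρ, hρ, hpos⟩ := hneg
      obtain ⟨l', h1, h2, h3⟩ := exists_shorter_word (s := affineReflection Φ p)
        (P := {g : V ≃ᵃ[ℝ] V | 0 < affineForm Φ p (g ρ)})
        (S := affineReflection Φ '' simpleAffine b ξ)
        (by rintro _ ⟨q, -, rfl⟩; exact affineReflection_mul_self hΦ q)
        (affineForm_pos hρ hp)
        (by
          rintro l hl _ ⟨r, hr, rfl⟩ hin hout
          -- Pulled back along the prefix, wall `p` becomes `q`, which separates ρ from its image
          -- under `r`. Hence q = r, and conjugation gives the required commutation.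
          obtain ⟨q, hq, hconj⟩ := exists_affineForm_comp hΦ (hgrp l hl) p
          have hin' : 0 < affineForm Φ q ρ := by rw [← hq]; exact hin
          have hout' : affineForm Φ q (affineReflection Φ r ρ) < 0 := by
            refine lt_of_le_of_ne ?_ ?_
            · rw [← hq]; exact not_lt.mp hout
            · obtain ⟨q', hq', -⟩ := exists_affineForm_comp hΦ (affineReflection_mem b r) q
              rw [hq']
              exact affineForm_ne_zero hξ hρ q'
          rw [hconj, eq_of_separates hΦ hξ hnorm hρ hr hin' hout'])
        l hl0 (by
          rw [Set.mem_ofPred_eq, not_lt]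
          have : affineForm Φ p ((affineReflection Φ p * l.prod) ρ) =
            -affineForm Φ p (l.prod ρ) := affineForm_affineReflection hΦ p _
          linarith)
      rw [← h3] at hla ⊢
      exact ih l'.length (by simp only [← hn, List.length_cons]; lia) l' rfl h1 hla

/-- Reflecting in the parallel hyperplanes ⟨α, x⟩ = 0 and then ⟨α, x⟩ = 1 is translation by α^∨. -/
lemma constVAdd_coroot (hΦ : IsEuclidean Φ) (i : ι) :
    AffineEquiv.constVAdd ℝ V (Φ.coroot i) =
      affineReflection Φ (Φ.reflectionPerm i i, 1) * (Φ.coreflection i).toAffineEquiv := by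
  ext x
  rw [AffineEquiv.coe_mul, Function.comp_apply, affineReflection_apply hΦ, affineForm,
    root_reflectionPerm_self, coroot_reflectionPerm_self, LinearEquiv.coe_toAffineEquiv,
    hΦ.coreflection_apply, inner_sub_right, inner_smul_right, inner_neg_left, inner_neg_left,
    hΦ.inner_root_coroot, Φ.pairing_same, AffineEquiv.constVAdd_apply, vadd_eq_add]
  push_cast
  module

lemma constVAdd_map (w : V ≃ₗ[ℝ] V) (v : V) :
    AffineEquiv.constVAdd ℝ V (w v) =
      w.toAffineEquiv * AffineEquiv.constVAdd ℝ V v * w.toAffineEquiv⁻¹ := by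
  rw [eq_mul_inv_iff_mul_eq]
  ext x
  exact (map_add w v x).symm

/-- The affine Weyl group is generated by the simple affine reflections. -/
lemma affineWeylGroup_le_closure (hΦ : IsEuclidean Φ) [Finite ι] [Φ.IsRootSystem]
    [Φ.IsCrystallographic] [Φ.IsReduced] [Φ.IsIrreducible] {b : Φ.Base} {ξ : ι}
    (hξ : IsHighestRoot b ξ) (hnorm : inner ℝ (Φ.root ξ) (Φ.root ξ) = 2) :
    affineWeylGroup b ≤ Subgroup.closure (affineReflection Φ '' simpleAffine b ξ) := by
  set H := Subgroup.closure (affineReflection Φ '' simpleAffine b ξ)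
  have hlin : ∀ w ∈ weylGroup b, w.toAffineEquiv ∈ H := by
    intro w hw
    induction hw using Subgroup.closure_induction with
    | mem w hw =>
      obtain ⟨i, hi, rfl⟩ := hw
      refine Subgroup.subset_closure ⟨(i, 0), Or.inl ⟨hi, rfl⟩, ?_⟩
      ext x
      rw [affineReflection_apply hΦ, affineForm, LinearEquiv.coe_toAffineEquiv,
        hΦ.coreflection_apply, Int.cast_zero, add_zero]
    | one => exact one_mem H
    | mul u v _ _ hu hv => exact mul_mem hu hv
    | inv u _ hu => exact inv_mem hu
  have htrans : ∀ q ∈ corootLattice b, AffineEquiv.constVAdd ℝ V q ∈ H := by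
    intro q hq
    -- Only ξ has a level-one reflection among the generators, so every translation is built from
    -- conjugates of the one by ξ^∨.
    replace hq := corootLattice_le_closure_conj_highest hΦ hξ hnorm hq
    induction hq using AddSubgroup.closure_induction with
    | mem q hq =>
      obtain ⟨w, hw, rfl⟩ := hq
      have h0 : AffineEquiv.constVAdd ℝ V (Φ.coroot ξ) ∈ H := by
        have h1 : affineReflection Φ (Φ.reflectionPerm ξ ξ, 1) ∈ H :=
          Subgroup.subset_closure ⟨_, Or.inr rfl, rfl⟩
        have h2 := hlin _ (coreflection_mem_weylGroup b ξ)
        rw [constVAdd_coroot hΦ ξ]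
        exact mul_mem h1 h2
      rw [constVAdd_map]
      exact mul_mem (mul_mem (hlin w hw) h0) (inv_mem (hlin w hw))
    | zero => rw [AffineEquiv.constVAdd_zero]; exact one_mem H
    | add x y _ _ hx hy => rw [AffineEquiv.constVAdd_add]; exact mul_mem hx hy
    | neg x _ hx => rw [← AffineEquiv.constVAdd_symm]; exact inv_mem hx
  intro g hg
  have hdec : g = AffineEquiv.constVAdd ℝ V (g 0) * g.linear.toAffineEquiv := by
    ext x
    rw [affineEquiv_apply_eq, add_comm]
    rfl
  rw [hdec]
  exact mul_mem (htrans _ hg.2) (hlin _ hg.1)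

/-- Two points of the fundamental domain in the same orbit of the affine Weyl group are equal. -/
theorem eq_of_mem_fundamentalDomain (hΦ : IsEuclidean Φ) [Finite ι] [Φ.IsRootSystem]
    [Φ.IsCrystallographic] [Φ.IsReduced] [Φ.IsIrreducible] {b : Φ.Base} {ξ : ι}
    (hξ : IsHighestRoot b ξ) (hnorm : inner ℝ (Φ.root ξ) (Φ.root ξ) = 2) {a : V}
    (ha : a ∈ fundamentalDomain b ξ) {g : V ≃ᵃ[ℝ] V} (hg : g ∈ affineWeylGroup b)
    (hga : g a ∈ fundamentalDomain b ξ) : g a = a := by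
  have hcl : g ∈ (Subgroup.closure (affineReflection Φ '' simpleAffine b ξ)).toSubmonoid :=
    affineWeylGroup_le_closure hΦ hξ hnorm hg
  rw [Subgroup.closure_toSubmonoid] at hcl
  obtain ⟨l, hl, rfl⟩ := Submonoid.exists_list_of_mem_closure hcl
  refine prod_apply_eq_self hΦ hξ hnorm ha l.length l rfl (fun g hg => ?_) hga
  rcases hl g hg with h | ⟨p, hp, hpg⟩
  · exact h
  · refine ⟨p, hp, ?_⟩
    rw [← inv_inv g, ← hpg]
    exact eq_inv_of_mul_eq_one_left (affineReflection_mul_self hΦ p)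

/-- Every orbit of the affine Weyl group meets the fundamental domain. -/
theorem exists_mem_fundamentalDomain (hΦ : IsEuclidean Φ) [Finite ι] [Φ.IsRootSystem]
    [Φ.IsCrystallographic] [Φ.IsReduced] (b : Φ.Base) (ξ : ι) (a : V) :
    ∃ w ∈ weylGroup b, ∃ q ∈ corootLattice b, w a + q ∈ fundamentalDomain b ξ := by
  obtain ⟨ρ, hρ⟩ := openAlcove_nonempty b ξ
  -- Orbit points no farther from ρ than a. There are finitely many linear parts, and for each only
  -- finitely many lattice translations stay in the ball, so a nearest point exists.
  let T : Set V := {x | (∃ g ∈ affineWeylGroup b, x = g a) ∧ ‖x - ρ‖ ≤ ‖a - ρ‖}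
  have hfin : T.Finite := by
    have hlat : ∀ q ∈ corootLattice b,
        q ∈ (Submodule.span ℤ (Set.range b.toCoweightBasis) : Submodule ℤ V) := by
      intro q hq
      induction hq using AddSubgroup.closure_induction with
      | mem x hx =>
        obtain ⟨i, hi, rfl⟩ := hx
        exact Submodule.subset_span ⟨⟨i, hi⟩, b.toCoweightBasis_apply _⟩
      | zero => exact zero_mem _
      | add x y _ _ hx hy => exact add_mem hx hy
      | neg x _ hx => exact neg_mem hx
    have : FiniteDimensional ℝ V := Module.Finite.of_basis b.toCoweightBasis
    have hb : ∀ w : weylGroup b, Set.Finite ((fun q => w.1 a + q) ''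
        (Metric.closedBall (ρ - w.1 a) ‖a - ρ‖ ∩
          (Submodule.span ℤ (Set.range b.toCoweightBasis) : Submodule ℤ V))) := fun w =>
      (ZSpan.setFinite_inter b.toCoweightBasis Metric.isBounded_closedBall).image _
    refine (Set.finite_iUnion hb).subset ?_
    rintro x ⟨⟨g, hg, rfl⟩, hx⟩
    refine Set.mem_iUnion.mpr ⟨⟨g.linear, hg.1⟩, g 0, ⟨?_, hlat _ hg.2⟩,
      (affineEquiv_apply_eq g a).symm⟩
    have hsub : g 0 - (ρ - g.linear a) = g a - ρ := by rw [affineEquiv_apply_eq g a]; abel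
    rw [mem_closedBall_iff_norm, hsub]
    exact hx
  obtain ⟨x, ⟨⟨g, hg, rfl⟩, hx⟩, hmin⟩ := Set.exists_min_image T (fun x => ‖x - ρ‖) hfin
    ⟨a, ⟨1, one_mem _, rfl⟩, le_rfl⟩
  refine ⟨g.linear, hg.1, g 0, hg.2, ?_⟩
  rw [← affineEquiv_apply_eq, mem_fundamentalDomain_iff]
  intro p hp
  have hle : ‖g a - ρ‖ ≤ ‖affineReflection Φ p (g a) - ρ‖ := by
    by_contra! h
    exact h.not_ge (hmin _ ⟨⟨_, mul_mem (affineReflection_mem b p) hg, rfl⟩, h.le.trans hx⟩)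
  have hsq := (sq_le_sq₀ (norm_nonneg _) (norm_nonneg _)).mpr hle
  rw [affineReflection_apply hΦ, ← real_inner_self_eq_norm_sq, ← real_inner_self_eq_norm_sq] at hsq
  set y := g a
  set f := affineForm Φ p y
  have hpos := affineForm_pos hρ hp
  have hN := inner_root_self_pos Φ p.1
  -- Reflecting y changes its squared distance to ρ by a positive multiple of the product of the
  -- forms at y and ρ; minimality thus makes the form at y non-negative.
  have hexp : inner ℝ (y - f • Φ.coroot p.1 - ρ) (y - f • Φ.coroot p.1 - ρ) =
      inner ℝ (y - ρ) (y - ρ) +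
        4 / inner ℝ (Φ.root p.1) (Φ.root p.1) * (f * affineForm Φ p ρ) := by
    have hf : inner ℝ (Φ.root p.1) y = f - p.2 := by simp [f, affineForm]
    have hr : inner ℝ (Φ.root p.1) ρ = affineForm Φ p ρ - p.2 := by simp [affineForm]
    simp only [hΦ.coroot_eq, inner_sub_left, inner_sub_right, inner_smul_left, inner_smul_right,
      conj_trivial, real_inner_comm (Φ.root p.1) y, real_inner_comm (Φ.root p.1) ρ, hf, hr]
    field_simp
    ring
  rw [hexp] at hsq
  have h4 : 0 < 4 / inner ℝ (Φ.root p.1) (Φ.root p.1) * affineForm Φ p ρ := by positivity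
  exact nonneg_of_mul_nonneg_left
    (by linarith : 0 ≤ f * (4 / inner ℝ (Φ.root p.1) (Φ.root p.1) * affineForm Φ p ρ)) h4

/-! ### Lattices and their indices -/

/-- The integer coordinates of one lattice basis in the other are its real coordinates, so the
integral determinant formula for the index may be evaluated over ℝ. -/
lemma relIndex_eq_abs_det_real {E κ : Type*} [AddCommGroup E] [Module ℝ E] [DecidableEq κ]
    [Fintype κ] {L₁ L₂ : AddSubgroup E} (H : L₁ ≤ L₂) (b₁ b₂ : Module.Basis κ ℝ E)
    (h₁ : L₁ = .closure (Set.range b₁)) (h₂ : L₂ = .closure (Set.range b₂)) :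
    (L₁.relIndex L₂ : ℝ) = |b₂.det b₁| := by
  rw [AddSubgroup.relIndex_eq_natAbs_det L₁ L₂ H (b₁.addSubgroupOfClosure L₁ h₁)
    (b₂.addSubgroupOfClosure L₂ h₂), Nat.cast_natAbs, Int.cast_abs]
  change |algebraMap ℤ ℝ _| = _
  rw [Module.Basis.det_apply, Module.Basis.det_apply, RingHom.map_det]
  congr
  ext i j
  have h := b₂.addSubgroupOfClosure_repr_apply L₂ h₂
    ⟨b₁ j, H (h₁ ▸ AddSubgroup.subset_closure ⟨j, rfl⟩)⟩ i
  simp only [RingHom.mapMatrix_apply, Matrix.map_apply, Module.Basis.toMatrix_apply,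
    Module.Basis.addSubgroupOfClosure_apply]
  exact h

lemma mem_closure_range_basis_iff {κ : Type*} (B : Module.Basis κ ℝ V) {x : V} :
    x ∈ AddSubgroup.closure (Set.range B) ↔ ∀ i, ∃ k : ℤ, B.repr x i = k := by
  rw [← Submodule.span_int_eq_addSubgroupClosure, Submodule.mem_toAddSubgroup,
    B.mem_span_iff_repr_mem ℤ]
  simp only [Set.mem_range, eq_intCast]
  exact forall_congr' fun i => exists_congr fun k => eq_comm

lemma corootLattice_eq_closure_range [Φ.IsRootSystem] (b : Φ.Base) :
    corootLattice b = AddSubgroup.closure (Set.range b.toCoweightBasis) := by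
  rw [corootLattice]
  congr 1
  ext x
  simp

lemma nondegenerate_innerₗ : (innerₗ V : LinearMap.BilinForm ℝ V).Nondegenerate := by
  refine ⟨fun x hx => ?_, fun x hx => ?_⟩ <;> exact inner_self_eq_zero.mp (hx x)

open Classical in
/-- The fundamental weights: the basis dual to the simple coroots. -/
noncomputable def fundamentalWeights [Φ.IsRootSystem] (b : Φ.Base) :
    Module.Basis b.support ℝ V :=
  LinearMap.BilinForm.dualBasis (innerₗ V) nondegenerate_innerₗ b.toCoweightBasis

lemma fundamentalWeights_repr [Φ.IsRootSystem] (b : Φ.Base) (x : V) (i : b.support) :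
    (fundamentalWeights b).repr x i = inner ℝ x (Φ.coroot i) := by
  simp [fundamentalWeights, LinearMap.BilinForm.dualBasis_repr_apply]

lemma weightLattice_eq_closure_range [Φ.IsRootSystem] (b : Φ.Base) :
    weightLattice b = AddSubgroup.closure (Set.range (fundamentalWeights b)) := by
  ext x
  rw [mem_closure_range_basis_iff]
  simp only [fundamentalWeights_repr]
  refine ⟨fun h i => h _ (coroot_mem_corootLattice b i), fun h q hq => ?_⟩
  induction hq using AddSubgroup.closure_induction with
  | mem q hq => obtain ⟨i, hi, rfl⟩ := hq; exact h ⟨i, hi⟩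
  | zero => exact ⟨0, by simp⟩
  | add u v _ _ hu hv =>
    obtain ⟨k, hk⟩ := hu
    obtain ⟨l, hl⟩ := hv
    exact ⟨k + l, by rw [inner_add_right, hk, hl]; push_cast; rfl⟩
  | neg u _ hu =>
    obtain ⟨k, hk⟩ := hu
    exact ⟨-k, by rw [inner_neg_right, hk]; push_cast; rfl⟩

/-- The coroot lattice is the full dual of the weight lattice. -/
lemma mem_corootLattice_of_forall_inner [Φ.IsRootSystem] {b : Φ.Base} {x : V}
    (h : ∀ p ∈ weightLattice b, ∃ k : ℤ, inner ℝ x p = (k : ℝ)) : x ∈ corootLattice b := by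
  classical
  rw [corootLattice_eq_closure_range, mem_closure_range_basis_iff]
  intro i
  -- Pairing x with the i-th fundamental weight reads off its i-th coordinate in the simple coroots.
  have hω : fundamentalWeights b i ∈ weightLattice b := by
    rw [weightLattice_eq_closure_range]
    exact AddSubgroup.subset_closure ⟨i, rfl⟩
  obtain ⟨k, hk⟩ := h _ hω
  refine ⟨k, ?_⟩
  rw [← hk, real_inner_comm]
  conv_rhs => rw [← b.toCoweightBasis.sum_repr x, inner_sum]
  simp_rw [inner_smul_right, b.toCoweightBasis_apply, ← fundamentalWeights_repr b]
  simp [Finsupp.single_apply]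

/-- The refined lattice `(1/M) P`. -/
def refinedLattice (b : Φ.Base) (M : ℕ) : AddSubgroup V :=
  (weightLattice b).comap (DistribSMul.toAddMonoidHom V (M : ℝ))

lemma mem_refinedLattice {b : Φ.Base} {M : ℕ} {x : V} :
    x ∈ refinedLattice b M ↔ (M : ℝ) • x ∈ weightLattice b := Iff.rfl

lemma weightLattice_le_refinedLattice (b : Φ.Base) (M : ℕ) :
    weightLattice b ≤ refinedLattice b M := fun x hx => by
  rw [mem_refinedLattice, Nat.cast_smul_eq_nsmul]
  exact nsmul_mem hx M

lemma inv_smul_mem_refinedLattice {b : Φ.Base} {M : ℕ} (hM : 0 < M) {p : V}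
    (hp : p ∈ weightLattice b) : (M : ℝ)⁻¹ • p ∈ refinedLattice b M := by
  rw [mem_refinedLattice, smul_inv_smul₀ (by positivity)]
  exact hp

lemma relIndex_weightLattice_refinedLattice [Φ.IsRootSystem] (b : Φ.Base) {M : ℕ} (hM : 0 < M) :
    (weightLattice b).relIndex (refinedLattice b M) = M ^ Module.finrank ℝ V := by
  classical
  have hM0 : (M : ℝ) ≠ 0 := by positivity
  let u : b.support → ℝˣ := fun _ => (Units.mk0 (M : ℝ) hM0)⁻¹
  have hA : refinedLattice b M =
      AddSubgroup.closure (Set.range ((fundamentalWeights b).unitsSMul u)) := by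
    ext x
    rw [mem_refinedLattice, weightLattice_eq_closure_range, mem_closure_range_basis_iff,
      mem_closure_range_basis_iff]
    simp [Module.Basis.repr_unitsSMul, u, Units.smul_def]
  have h := relIndex_eq_abs_det_real (weightLattice_le_refinedLattice b M) (fundamentalWeights b)
    ((fundamentalWeights b).unitsSMul u) (weightLattice_eq_closure_range b) hA
  rw [Module.Basis.det_unitsSMul, AlternatingMap.smul_apply, Module.Basis.det_self] at h
  rw [Module.finrank_eq_card_basis (fundamentalWeights b)]
  have : (((weightLattice b).relIndex (refinedLattice b M) : ℕ) : ℝ) =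
      ((M ^ Fintype.card b.support : ℕ) : ℝ) := by
    rw [h]
    simp [u]
  exact_mod_cast this

/-- `relIndex` is 0 for infinite index; the nonzero determinant between two real bases excludes
this, and finiteness of the grid quotient follows. -/
lemma latticeIndex_ne_zero [Φ.IsRootSystem] {b : Φ.Base}
    (hQP : corootLattice b ≤ weightLattice b) : latticeIndex b ≠ 0 := by
  classical
  have h := relIndex_eq_abs_det_real hQP _ _ (corootLattice_eq_closure_range b)
    (weightLattice_eq_closure_range b)
  have hu := ((fundamentalWeights b).isUnit_det b.toCoweightBasis).ne_zero
  intro h0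
  rw [latticeIndex] at h0
  rw [h0, Nat.cast_zero, eq_comm, abs_eq_zero] at h
  exact hu h

lemma relIndex_corootLattice_refinedLattice [Φ.IsRootSystem] {b : Φ.Base} {M : ℕ} (hM : 0 < M)
    (hQP : corootLattice b ≤ weightLattice b) :
    (corootLattice b).relIndex (refinedLattice b M) =
      latticeIndex b * M ^ Module.finrank ℝ V := by
  rw [← AddSubgroup.relIndex_mul_relIndex _ _ _ hQP (weightLattice_le_refinedLattice b M),
    relIndex_weightLattice_refinedLattice b hM, latticeIndex]

lemma weylGroup_map_weightLattice (hΦ : IsEuclidean Φ) {b : Φ.Base} {w : V ≃ₗ[ℝ] V}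
    (hw : w ∈ weylGroup b) {x : V} (hx : x ∈ weightLattice b) : w x ∈ weightLattice b := by
  intro q hq
  rw [weylGroup_inner_left hΦ hw]
  exact hx _ (weylGroup_map_corootLattice b (inv_mem hw) hq)

lemma weylGroup_map_refinedLattice (hΦ : IsEuclidean Φ) {b : Φ.Base} {M : ℕ} {w : V ≃ₗ[ℝ] V}
    (hw : w ∈ weylGroup b) {x : V} (hx : x ∈ refinedLattice b M) : w x ∈ refinedLattice b M := by
  rw [mem_refinedLattice, ← map_smul]
  exact weylGroup_map_weightLattice hΦ hw hx

lemma weylGroup_map_corootLattice_iff {b : Φ.Base} {w : V ≃ₗ[ℝ] V}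
    (hw : w ∈ weylGroup b) {q : V} : w q ∈ corootLattice b ↔ q ∈ corootLattice b := by
  refine ⟨fun h => ?_, weylGroup_map_corootLattice b hw⟩
  have := weylGroup_map_corootLattice b (inv_mem hw) h
  rwa [← LinearEquiv.mul_apply, inv_mul_cancel] at this

/-! ### The finite quotient and its characters -/

/-- The finite group `(1/M) P / Q^∨`. -/
abbrev gridQuotient (b : Φ.Base) (M : ℕ) : Type _ :=
  refinedLattice b M ⧸ (corootLattice b).addSubgroupOf (refinedLattice b M)

/-- A representative in `V` of a class of the grid quotient. -/
noncomputable def gridRep {b : Φ.Base} {M : ℕ} (y : gridQuotient b M) : V :=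
  (Quotient.out y : refinedLattice b M)

lemma gridRep_mem {b : Φ.Base} {M : ℕ} (y : gridQuotient b M) : gridRep y ∈ refinedLattice b M :=
  (Quotient.out y : refinedLattice b M).2

lemma eq_mk_iff {b : Φ.Base} {M : ℕ} (y : gridQuotient b M) (z : refinedLattice b M) :
    y = QuotientAddGroup.mk z ↔ gridRep y - z ∈ corootLattice b := by
  conv_lhs => rw [← QuotientAddGroup.out_eq' y]
  rw [eq_comm, QuotientAddGroup.eq, AddSubgroup.mem_addSubgroupOf]
  simp [gridRep, neg_add_eq_sub]

lemma gridRep_mk {b : Φ.Base} {M : ℕ} (z : refinedLattice b M) :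
    ∃ q ∈ corootLattice b, gridRep (QuotientAddGroup.mk z : gridQuotient b M) = z + q :=
  ⟨_, (eq_mk_iff _ z).mp rfl, by abel⟩

lemma finite_gridQuotient [Φ.IsRootSystem] {b : Φ.Base} {M : ℕ} (hM : 0 < M)
    (hQP : corootLattice b ≤ weightLattice b) : Finite (gridQuotient b M) := by
  refine Nat.finite_of_card_ne_zero ?_
  change (corootLattice b).relIndex (refinedLattice b M) ≠ 0
  rw [relIndex_corootLattice_refinedLattice hM hQP]
  exact mul_ne_zero (latticeIndex_ne_zero hQP) (by positivity)

/-- The exponential `e^{2πi⟨x, a⟩}`. -/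
noncomputable def expInner (x a : V) : ℂ :=
  Complex.exp (2 * Real.pi * Complex.I * ((inner ℝ x a : ℝ) : ℂ))

lemma expInner_add_right (x a c : V) : expInner x (a + c) = expInner x a * expInner x c := by
  rw [expInner, expInner, expInner, ← Complex.exp_add, inner_add_right]
  congr 1
  push_cast
  ring

lemma expInner_sub_left (x y a : V) :
    expInner (x - y) a = expInner x a * starRingEnd ℂ (expInner y a) := by
  rw [expInner, expInner, expInner, ← Complex.exp_conj, ← Complex.exp_add, inner_sub_left]
  congr 1
  simp only [map_mul, Complex.conj_ofReal, Complex.conj_I, map_ofNat]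
  push_cast
  ring

lemma expInner_eq_one_iff (x a : V) : expInner x a = 1 ↔ ∃ k : ℤ, inner ℝ x a = (k : ℝ) := by
  rw [expInner, Complex.exp_eq_one_iff]
  refine exists_congr fun k => ?_
  have h : (2 * Real.pi * Complex.I : ℂ) ≠ 0 := Complex.two_pi_I_ne_zero
  rw [mul_comm (k : ℂ), mul_right_inj' h]
  norm_cast

lemma expInner_add_corootLattice {b : Φ.Base} {x a q : V} (hx : x ∈ weightLattice b)
    (hq : q ∈ corootLattice b) : expInner x (a + q) = expInner x a := by
  rw [expInner_add_right, (expInner_eq_one_iff x q).mpr (hx q hq), mul_one]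

open Classical in
/-- Orthogonality of the characters of `(1/M) P / Q^∨`. -/
lemma sum_expInner [Φ.IsRootSystem] {b : Φ.Base} {M : ℕ} (hM : 0 < M)
    (hQP : corootLattice b ≤ weightLattice b) [Fintype (gridQuotient b M)] {x : V}
    (hx : x ∈ weightLattice b) :
    ∑ y : gridQuotient b M, expInner x (gridRep y) =
      if (M : ℝ)⁻¹ • x ∈ corootLattice b then
        (latticeIndex b : ℂ) * (M : ℂ) ^ Module.finrank ℝ V else 0 := by
  have hM0 : (M : ℝ) ≠ 0 := by positivity
  split_ifs with h
  · have h1 : ∀ y : gridQuotient b M, expInner x (gridRep y) = 1 := fun y => by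
      rw [expInner_eq_one_iff]
      obtain ⟨k, hk⟩ := gridRep_mem y _ h
      refine ⟨k, ?_⟩
      change inner ℝ ((M : ℝ) • gridRep y) _ = _ at hk
      rw [inner_smul_left, inner_smul_right, conj_trivial, mul_inv_cancel_left₀ hM0] at hk
      rw [real_inner_comm, hk]
    simp only [h1, Finset.sum_const, nsmul_eq_mul, mul_one]
    rw [Finset.card_univ, ← Nat.card_eq_fintype_card]
    change (((corootLattice b).relIndex (refinedLattice b M) : ℕ) : ℂ) = _
    rw [relIndex_corootLattice_refinedLattice hM hQP]
    push_cast
    rfl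
  -- If the character were trivial, x/M would pair integrally with P and so lie in Q^∨ by duality.
  -- Shifting by a p with nontrivial value multiplies the sum by that value, so the sum is 0.
  · obtain ⟨p, hp, hne⟩ : ∃ p ∈ refinedLattice b M, expInner x p ≠ 1 := by
      by_contra! hall
      refine h (mem_corootLattice_of_forall_inner fun p hp => ?_)
      obtain ⟨k, hk⟩ := (expInner_eq_one_iff _ _).mp (hall _ (inv_smul_mem_refinedLattice hM hp))
      refine ⟨k, ?_⟩
      rw [inner_smul_left, conj_trivial, ← inner_smul_right, hk]
    have hshift : ∀ y : gridQuotient b M,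
        expInner x (gridRep (y + QuotientAddGroup.mk ⟨p, hp⟩)) =
          expInner x (gridRep y) * expInner x p := fun y => by
      have hy : y + QuotientAddGroup.mk ⟨p, hp⟩ =
          QuotientAddGroup.mk (⟨gridRep y, gridRep_mem y⟩ + ⟨p, hp⟩ : refinedLattice b M) := by
        rw [QuotientAddGroup.mk_add]
        congr 1
        exact (eq_mk_iff y ⟨gridRep y, gridRep_mem y⟩).mpr (by simp)
      obtain ⟨q, hq, hr⟩ := gridRep_mk (⟨gridRep y, gridRep_mem y⟩ + ⟨p, hp⟩ : refinedLattice b M)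
      rw [hy, hr, expInner_add_corootLattice hx hq, ← expInner_add_right]
      rfl
    have hs := Equiv.sum_comp (Equiv.addRight (QuotientAddGroup.mk ⟨p, hp⟩ : gridQuotient b M))
      fun y => expInner x (gridRep y)
    simp only [Equiv.coe_addRight, hshift, ← Finset.sum_mul] at hs
    by_contra h0
    exact hne (mul_left_cancel₀ h0 (by rw [hs, mul_one]))

/-! ### Folding sums over the quotient onto the fundamental domain -/

/-- The element `T(q) w` of the affine Weyl group. -/
def affineElement {b : Φ.Base} {w : V ≃ₗ[ℝ] V} (hw : w ∈ weylGroup b) {q : V}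
    (hq : q ∈ corootLattice b) : affineWeylGroup b :=
  ⟨AffineEquiv.constVAdd ℝ V q * w.toAffineEquiv, by
    refine ⟨hw, ?_⟩
    change q + w 0 ∈ _
    rwa [map_zero, add_zero]⟩

lemma affineElement_apply {b : Φ.Base} {w : V ≃ₗ[ℝ] V} (hw : w ∈ weylGroup b) {q : V}
    (hq : q ∈ corootLattice b) (x : V) : (affineElement hw hq).1 x = w x + q :=
  add_comm _ _

lemma retraction_affineElement {b : Φ.Base} {w : V ≃ₗ[ℝ] V} (hw : w ∈ weylGroup b) {q : V}
    (hq : q ∈ corootLattice b) : retraction b (affineElement hw hq) = ⟨w, hw⟩ :=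
  rfl

open Classical in
-- A stabilizer element is determined by its linear part w, since its translation must be a - w a.
lemma stabOrder_eq_card [Finite ι] [Φ.IsRootSystem] (b : Φ.Base) (a : V) :
    stabOrder b a =
      (Finset.univ.filter fun w : weylGroup b => a - w.1 a ∈ corootLattice b).card := by
  rw [stabOrder, ← Fintype.card_subtype, ← Nat.card_eq_fintype_card]
  refine Nat.card_congr (Equiv.ofBijective
    (fun g => ⟨retraction b g.1, ?_⟩) ⟨fun g g' h => ?_, fun w => ?_⟩)
  · have hg : g.1.1 a = a := g.2
    rw [affineEquiv_apply_eq] at hg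
    have : a - (retraction b g.1).1 a = g.1.1 0 := sub_eq_of_eq_add' hg.symm
    rw [this]
    exact g.1.2.2
  · have hl : g.1.1.linear = g'.1.1.linear := congrArg (fun w => w.1.1) h
    have hg : g.1.1 a = a := g.2
    have hg' : g'.1.1 a = a := g'.2
    have h0 : g.1.1 0 = g'.1.1 0 := by
      rw [affineEquiv_apply_eq] at hg hg'
      rw [hl] at hg
      exact add_left_cancel (hg.trans hg'.symm)
    refine Subtype.ext (Subtype.ext (AffineEquiv.ext fun x => ?_))
    rw [affineEquiv_apply_eq, affineEquiv_apply_eq g'.1.1, hl, h0]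
  · refine ⟨⟨affineElement w.1.2 w.2, ?_⟩, ?_⟩
    · change (affineElement w.1.2 w.2).1 a = a
      rw [affineElement_apply]
      abel
    · rfl

section Fold

variable [Finite ι] [Φ.IsRootSystem] [Φ.IsCrystallographic] [Φ.IsReduced] [Φ.IsIrreducible]

lemma eq_of_weyl_add_mem_fundamentalDomain (hΦ : IsEuclidean Φ) {b : Φ.Base} {ξ : ι}
    (hξ : IsHighestRoot b ξ) (hnorm : inner ℝ (Φ.root ξ) (Φ.root ξ) = 2) {a a' : V}
    (ha : a ∈ fundamentalDomain b ξ) (ha' : a' ∈ fundamentalDomain b ξ) {w w' : V ≃ₗ[ℝ] V}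
    (hw : w ∈ weylGroup b) (hw' : w' ∈ weylGroup b) (h : w a - w' a' ∈ corootLattice b) :
    a = a' := by
  have hq := weylGroup_map_corootLattice b (inv_mem hw) h
  have hval : a = (affineElement (mul_mem (inv_mem hw) hw') hq).1 a' := by
    rw [affineElement_apply, LinearEquiv.mul_apply, map_sub, add_sub_cancel,
      ← LinearEquiv.mul_apply, inv_mul_cancel]
    rfl
  rw [hval] at ha ⊢
  exact eq_of_mem_fundamentalDomain hΦ hξ hnorm ha' (Subtype.property _) ha

/-- Distinct points of `F` are inequivalent already under Q^∨, so they embed in the finite quotient.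
-/
lemma finite_refinedLattice_inter_fundamentalDomain (hΦ : IsEuclidean Φ) {b : Φ.Base} {ξ : ι}
    (hξ : IsHighestRoot b ξ) (hnorm : inner ℝ (Φ.root ξ) (Φ.root ξ) = 2) {M : ℕ} (hM : 0 < M) :
    {a | a ∈ refinedLattice b M ∧ a ∈ fundamentalDomain b ξ}.Finite := by
  have := finite_gridQuotient hM (corootLattice_le_weightLattice hΦ hξ hnorm)
  refine Set.finite_coe_iff.mp (Finite.of_injective
    (fun a => (QuotientAddGroup.mk ⟨a.1, a.2.1⟩ : gridQuotient b M)) fun a a' h => ?_)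
  rw [QuotientAddGroup.eq, AddSubgroup.mem_addSubgroupOf] at h
  refine Subtype.ext (eq_of_weyl_add_mem_fundamentalDomain hΦ hξ hnorm a'.2.2 a.2.2 (one_mem _)
    (one_mem _) ?_).symm
  rw [sub_eq_neg_add]
  exact h

/-- Summation over `(1/M) P / Q^∨` of a function invariant under the affine Weyl group. -/
lemma sum_gridRep_eq (hΦ : IsEuclidean Φ) {b : Φ.Base} {ξ : ι}
    (hξ : IsHighestRoot b ξ) (hnorm : inner ℝ (Φ.root ξ) (Φ.root ξ) = 2) {M : ℕ}
    [Fintype (gridQuotient b M)] {D : Finset V}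
    (hD : ∀ a, a ∈ D ↔ a ∈ refinedLattice b M ∧ a ∈ fundamentalDomain b ξ) {f : V → ℂ}
    (hf : ∀ w ∈ weylGroup b, ∀ q ∈ corootLattice b, ∀ a, f (w a + q) = f a) :
    ∑ y : gridQuotient b M, f (gridRep y) = ∑ a ∈ D, (orbitWeight b a : ℂ) * f a := by
  classical
  have hone : ∀ z ∈ refinedLattice b M,
      ∑ y : gridQuotient b M, (if gridRep y - z ∈ corootLattice b then (1 : ℂ) else 0) = 1 := by
    intro z hz
    have : ∀ y : gridQuotient b M, gridRep y - z ∈ corootLattice b ↔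
      y = QuotientAddGroup.mk ⟨z, hz⟩ := fun y => (eq_mk_iff y ⟨z, hz⟩).symm
    simp [this]
  have hpos : ∀ a, (stabOrder b a : ℂ) ≠ 0 := fun a =>
    Nat.cast_ne_zero.mpr (Nat.card_pos (α := affineStabilizer b a)).ne'
  -- Double counting of pairs (y, w) with y ≡ w a modulo Q^∨: each w meets exactly one class y,
  -- which yields the factor |W|/h(a).
  have hright : ∀ a ∈ D, (orbitWeight b a : ℂ) * f a = ∑ y : gridQuotient b M,
      ∑ w : weylGroup b, if gridRep y - w.1 a ∈ corootLattice b then f a / stabOrder b a else 0 := by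
    intro a ha
    rw [Finset.sum_comm]
    have h1 : ∀ w : weylGroup b, ∑ y : gridQuotient b M,
        (if gridRep y - w.1 a ∈ corootLattice b then f a / stabOrder b a else 0) =
          f a / stabOrder b a := fun w => by
      have := hone (w.1 a) (weylGroup_map_refinedLattice hΦ w.2 ((hD a).mp ha).1)
      calc _ = ∑ y : gridQuotient b M, (f a / stabOrder b a) *
          (if gridRep y - w.1 a ∈ corootLattice b then (1 : ℂ) else 0) := by simp
        _ = _ := by rw [← Finset.mul_sum, this, mul_one]
    rw [Finset.sum_congr rfl fun w _ => h1 w, Finset.sum_const, Finset.card_univ,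
      ← Nat.card_eq_fintype_card, orbitWeight, nsmul_eq_mul]
    push_cast
    ring
  rw [Finset.sum_congr rfl hright, Finset.sum_comm]
  refine Finset.sum_congr rfl fun y _ => ?_
  obtain ⟨w, hw, q, hq, hF⟩ := exists_mem_fundamentalDomain hΦ b ξ (gridRep y)
  set a₀ := w (gridRep y) + q with ha₀
  have hQA : corootLattice b ≤ refinedLattice b M :=
    (corootLattice_le_weightLattice hΦ hξ hnorm).trans (weightLattice_le_refinedLattice b M)
  have ha₀D : a₀ ∈ D := (hD a₀).mpr
    ⟨add_mem (weylGroup_map_refinedLattice hΦ hw (gridRep_mem y)) (hQA hq), hF⟩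
  have hy : ∀ x, gridRep y - x ∈ corootLattice b ↔ a₀ - w x ∈ corootLattice b := fun x => by
    rw [← weylGroup_map_corootLattice_iff hw, map_sub, ha₀, add_sub_right_comm,
      add_mem_cancel_right hq]
  simp only [hy]
  -- For fixed y only its representative a₀ in `F` contributes, and the w with y ≡ w a₀ form a coset
  -- of the linear parts of the stabilizer of a₀, hence number h(a₀).
  rw [Finset.sum_eq_single a₀]
  · rw [← hf w hw q hq, ← ha₀]
    rw [← Finset.sum_filter, Finset.sum_const, nsmul_eq_mul]
    have hcard : (Finset.univ.filter fun u : weylGroup b =>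
        a₀ - w (u.1 a₀) ∈ corootLattice b).card = stabOrder b a₀ := by
      rw [stabOrder_eq_card]
      refine Finset.card_bij (fun u _ => ⟨w, hw⟩ * u) ?_ (fun u _ u' _ h => mul_left_cancel h) ?_
      · intro u hu
        simpa [LinearEquiv.mul_apply] using hu
      · intro u hu
        refine ⟨⟨w, hw⟩⁻¹ * u, ?_, by simp⟩
        simp only [Finset.mem_filter, Finset.mem_univ, true_and] at hu ⊢
        change a₀ - (w * (w⁻¹ * u.1)) a₀ ∈ _
        rwa [mul_inv_cancel_left]
    rw [hcard, mul_div_cancel₀ _ (hpos a₀)]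
  · intro a ha hne
    refine Finset.sum_eq_zero fun u _ => if_neg fun h => hne ?_
    exact (eq_of_weyl_add_mem_fundamentalDomain hΦ hξ hnorm hF ((hD a).mp ha).2 (one_mem _)
      (mul_mem hw u.2) h).symm
  · exact fun h => absurd ha₀D h

end Fold

/-! ### Orbit functions -/

section Orbit

variable [Finite ι] [Φ.IsRootSystem]

lemma unitsInt_sq_cast (e : ℤˣ) : ((e : ℤ) : ℂ) * ((e : ℤ) : ℂ) = 1 := by
  rcases Int.units_eq_one_or e with rfl | rfl <;> simp

/-- Translations drop out because every weight in the orbit of λ is integral on Q^∨; the sign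
appears on reindexing the sum by w⁻¹. -/
lemma orbitFunction_map (hΦ : IsEuclidean Φ) {b : Φ.Base} (σ : weylGroup b →* ℤˣ) {l : V}
    (hl : l ∈ weightLattice b) (w : weylGroup b) {q : V} (hq : q ∈ corootLattice b) (a : V) :
    orbitFunction b σ l (w.1 a + q) = ((σ w : ℤˣ) : ℤ) * orbitFunction b σ l a := by
  rw [orbitFunction, orbitFunction, Finset.mul_sum]
  refine Fintype.sum_equiv (Equiv.mulLeft w⁻¹) _ _ fun u => ?_
  change (((σ u : ℤˣ) : ℤ) : ℂ) * expInner (u.1 l) (w.1 a + q) =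
    (((σ w : ℤˣ) : ℤ) : ℂ) * ((((σ (w⁻¹ * u) : ℤˣ) : ℤ) : ℂ) * expInner ((w⁻¹ * u).1 l) a)
  rw [expInner_add_corootLattice (weylGroup_map_weightLattice hΦ u.2 hl) hq, ← mul_assoc]
  congr 1
  · rw [← Int.cast_mul, ← Units.val_mul, ← map_mul, mul_inv_cancel_left]
  · rw [expInner, expInner]
    have : inner ℝ ((w⁻¹ * u).1 l) a = inner ℝ (u.1 l) (w.1 a) := by
      change inner ℝ (w.1⁻¹ (u.1 l)) a = _
      rw [weylGroup_inner_left hΦ (inv_mem w.2), inv_inv]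
    rw [this]

/-- The transformation rule at a fixed point with sign -1 gives φ(a) = -φ(a). This is why the grid
may omit the points of `F` outside F^σ. -/
lemma orbitFunction_eq_zero (hΦ : IsEuclidean Φ) {b : Φ.Base} (σ : weylGroup b →* ℤˣ) {l : V}
    (hl : l ∈ weightLattice b) {a : V} {g : affineWeylGroup b} (hg : g ∈ affineStabilizer b a)
    (hσ : σ (retraction b g) ≠ 1) : orbitFunction b σ l a = 0 := by
  have hfix : g.1 a = a := hg
  have h := orbitFunction_map hΦ σ hl (retraction b g) g.2.2 a
  have hga : (retraction b g).1 a + g.1 0 = a := (affineEquiv_apply_eq g.1 a).symm.trans hfix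
  rw [hga, (Int.units_eq_one_or _).resolve_left hσ] at h
  have h2 : (2 : ℂ) * orbitFunction b σ l a = 0 := by
    push_cast at h
    linear_combination h
  simpa using h2

open Classical in
-- Replacing the second summation variable by w u turns the exponent into w(λ - u λ'). Since W
-- preserves Q^∨, character orthogonality gives a value independent of w, whence the factor |W|.
lemma sum_orbitFunction_mul_conj (hΦ : IsEuclidean Φ) {b : Φ.Base} {M : ℕ} (hM : 0 < M)
    (hQP : corootLattice b ≤ weightLattice b) [Fintype (gridQuotient b M)]
    (σ : weylGroup b →* ℤˣ) {l l' : V} (hl : l ∈ weightLattice b) (hl' : l' ∈ weightLattice b) :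
    ∑ y : gridQuotient b M, orbitFunction b σ l (gridRep y) *
        starRingEnd ℂ (orbitFunction b σ l' (gridRep y)) =
      (latticeIndex b : ℂ) * (M : ℂ) ^ Module.finrank ℝ V * (Nat.card (weylGroup b) : ℂ) *
        ∑ u : weylGroup b, if (M : ℝ)⁻¹ • l - u.1 ((M : ℝ)⁻¹ • l') ∈ corootLattice b then
          (((σ u : ℤˣ) : ℤ) : ℂ) else 0 := by
  have hexp : ∀ a, orbitFunction b σ l a * starRingEnd ℂ (orbitFunction b σ l' a) =
      ∑ w : weylGroup b, ∑ u : weylGroup b,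
        (((σ u : ℤˣ) : ℤ) : ℂ) * expInner (w.1 (l - u.1 l')) a := by
    intro a
    rw [orbitFunction, orbitFunction, map_sum, Finset.sum_mul_sum]
    refine Finset.sum_congr rfl fun w _ => ?_
    refine Fintype.sum_equiv (Equiv.mulLeft w⁻¹) _ _ fun u => ?_
    have h1 : w.1 (l - ((Equiv.mulLeft w⁻¹) u).1 l') = w.1 l - u.1 l' := by
      rw [map_sub]
      congr 1
      change (w.1 * (w.1⁻¹ * u.1)) l' = _
      rw [mul_inv_cancel_left]
    rw [h1, expInner_sub_left, expInner, expInner, Equiv.coe_mulLeft, map_mul, map_mul, map_inv,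
      Int.units_inv_eq_self, map_intCast]
    push_cast
    ring
  simp only [hexp]
  rw [Finset.sum_comm, Finset.sum_congr rfl fun w _ => Finset.sum_comm]
  simp only [← Finset.mul_sum]
  have hsum : ∀ w u : weylGroup b,
      ∑ y : gridQuotient b M, expInner (w.1 (l - u.1 l')) (gridRep y) =
        if (M : ℝ)⁻¹ • l - u.1 ((M : ℝ)⁻¹ • l') ∈ corootLattice b then
          (latticeIndex b : ℂ) * (M : ℂ) ^ Module.finrank ℝ V else 0 := fun w u => by
    rw [sum_expInner hM hQP (weylGroup_map_weightLattice hΦ w.2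
      (sub_mem hl (weylGroup_map_weightLattice hΦ u.2 hl')))]
    rw [← map_smul, weylGroup_map_corootLattice_iff w.2, smul_sub, ← map_smul]
  simp only [hsum, Finset.sum_const, Finset.card_univ, nsmul_eq_mul, ← Nat.card_eq_fintype_card]
  rw [Finset.mul_sum, Finset.mul_sum]
  refine Finset.sum_congr rfl fun u _ => ?_
  split_ifs <;> ring

end Orbit

/-! ### The two grids and discrete orthogonality -/

lemma argumentGrid_subset {b : Φ.Base} {ξ : ι} {σ : weylGroup b →* ℤˣ} {M : ℕ} (hM : 0 < M) :
    argumentGrid b ξ σ M ⊆ {a | a ∈ refinedLattice b M ∧ a ∈ fundamentalDomain b ξ} := by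
  rintro _ ⟨⟨p, hp, rfl⟩, ha⟩
  exact ⟨inv_smul_mem_refinedLattice hM hp, ha.1⟩

lemma mem_labelGrid {b : Φ.Base} {ξ : ι} {σ : weylGroup b →* ℤˣ} {M : ℕ} (hM : 0 < M) {l : V}
    (hl : l ∈ labelGrid b ξ σ M) :
    l ∈ weightLattice b ∧ (M : ℝ)⁻¹ • l ∈ signedDomain b ξ σ := by
  obtain ⟨hP, x, hx, rfl⟩ := hl
  refine ⟨hP, ?_⟩
  simp only
  rwa [inv_smul_smul₀ (by positivity)]

section Main

variable [Finite ι] [Φ.IsRootSystem] [Φ.IsCrystallographic] [Φ.IsReduced] [Φ.IsIrreducible]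

/-- The product is invariant under W^aff since σ(w)² = 1, so it folds onto `F`; the points removed
in passing to F^σ contribute 0. -/
lemma gridInner_orbitFunction (hΦ : IsEuclidean Φ) {b : Φ.Base} {ξ : ι}
    (hξ : IsHighestRoot b ξ) (hnorm : inner ℝ (Φ.root ξ) (Φ.root ξ) = 2) {M : ℕ} (hM : 0 < M)
    [Fintype (gridQuotient b M)] (σ : weylGroup b →* ℤˣ) {l l' : V} (hl : l ∈ weightLattice b)
    (hl' : l' ∈ weightLattice b) :
    gridInner b ξ σ M (orbitFunction b σ l) (orbitFunction b σ l') =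
      ∑ y : gridQuotient b M, orbitFunction b σ l (gridRep y) *
        starRingEnd ℂ (orbitFunction b σ l' (gridRep y)) := by
  have hfin := finite_refinedLattice_inter_fundamentalDomain hΦ hξ hnorm hM
  have hinv : ∀ w ∈ weylGroup b, ∀ q ∈ corootLattice b, ∀ a,
      orbitFunction b σ l (w a + q) * starRingEnd ℂ (orbitFunction b σ l' (w a + q)) =
        orbitFunction b σ l a * starRingEnd ℂ (orbitFunction b σ l' a) := by
    intro w hw q hq a
    rw [orbitFunction_map hΦ σ hl ⟨w, hw⟩ hq, orbitFunction_map hΦ σ hl' ⟨w, hw⟩ hq, map_mul,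
      map_intCast, mul_mul_mul_comm, unitsInt_sq_cast, one_mul]
  rw [sum_gridRep_eq hΦ hξ hnorm (D := hfin.toFinset) (fun a => hfin.mem_toFinset)
    (f := fun a => orbitFunction b σ l a * starRingEnd ℂ (orbitFunction b σ l' a)) hinv,
    gridInner, finsum_mem_eq_finite_toFinset_sum _ (hfin.subset (argumentGrid_subset hM))]
  simp only [mul_assoc]
  refine Finset.sum_subset (Set.Finite.toFinset_subset_toFinset.mpr (argumentGrid_subset hM))
    fun a ha hna => ?_
  rw [hfin.mem_toFinset] at ha
  rw [Set.Finite.mem_toFinset] at hna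
  obtain ⟨g, hg, hσ⟩ : ∃ g ∈ affineStabilizer b a, σ (retraction b g) ≠ 1 := by
    by_contra! h
    exact hna ⟨⟨(M : ℝ) • a, ha.1, inv_smul_smul₀ (by positivity) a⟩, ha.2, h⟩
  rw [orbitFunction_eq_zero hΦ σ hl hg hσ, zero_mul, mul_zero]

end Main

end WeylOrbit

theorem mainTheorem1 {ι V : Type*} [Finite ι] [NormedAddCommGroup V] [InnerProductSpace ℝ V]
    [DecidableEq V]
    (Φ : RootPairing ι ℝ V V) [Φ.IsRootSystem] [Φ.IsCrystallographic] [Φ.IsReduced]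
    [Φ.IsIrreducible] (hΦ : WeylOrbit.IsEuclidean Φ)
    (b : Φ.Base) (ξ : ι) (hξ : WeylOrbit.IsHighestRoot b ξ)
    (hnorm : inner ℝ (Φ.root ξ) (Φ.root ξ) = 2)
    (σ : WeylOrbit.weylGroup b →* ℤˣ) (M : ℕ) (hM : 0 < M) :
    (WeylOrbit.argumentGrid b ξ σ M).Finite ∧
    ∀ l ∈ WeylOrbit.labelGrid b ξ σ M, ∀ l' ∈ WeylOrbit.labelGrid b ξ σ M,
      WeylOrbit.gridInner b ξ σ M (WeylOrbit.orbitFunction b σ l) (WeylOrbit.orbitFunction b σ l') =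
        (WeylOrbit.latticeIndex b : ℂ) * (Nat.card (WeylOrbit.weylGroup b) : ℂ) *
          (M : ℂ) ^ Module.finrank ℝ V * (WeylOrbit.stabOrderScaled b M l : ℂ) *
          (if l = l' then 1 else 0) := by
  classical
  refine ⟨(WeylOrbit.finite_refinedLattice_inter_fundamentalDomain hΦ hξ hnorm hM).subset
    (WeylOrbit.argumentGrid_subset hM), fun l hl l' hl' => ?_⟩
  have hQP := WeylOrbit.corootLattice_le_weightLattice hΦ hξ hnorm
  have := WeylOrbit.finite_gridQuotient hM hQP
  have := Fintype.ofFinite (WeylOrbit.gridQuotient b M)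
  obtain ⟨hlP, hlF⟩ := WeylOrbit.mem_labelGrid hM hl
  obtain ⟨hlP', hlF'⟩ := WeylOrbit.mem_labelGrid hM hl'
  rw [WeylOrbit.gridInner_orbitFunction hΦ hξ hnorm hM σ hlP hlP',
    WeylOrbit.sum_orbitFunction_mul_conj hΦ hM hQP σ hlP hlP']
  split_ifs with h
  · subst h
    have hsum : (∑ u : WeylOrbit.weylGroup b,
        if (M : ℝ)⁻¹ • l - u.1 ((M : ℝ)⁻¹ • l) ∈ WeylOrbit.corootLattice b then
          (((σ u : ℤˣ) : ℤ) : ℂ) else 0) = (WeylOrbit.stabOrderScaled b M l : ℂ) := by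
      rw [WeylOrbit.stabOrderScaled, WeylOrbit.stabOrder_eq_card, ← Finset.sum_filter,
        Finset.cast_card]
      refine Finset.sum_congr rfl fun u hu => ?_
      have hq := (Finset.mem_filter.mp hu).2
      -- Each u counted is the linear part of an element fixing λ/M, and λ/M ∈ F^σ makes its sign 1.
      have h1 := hlF.2 (WeylOrbit.affineElement u.2 hq) (by
        change (WeylOrbit.affineElement u.2 hq).1 _ = _
        rw [WeylOrbit.affineElement_apply, add_sub_cancel])
      rw [WeylOrbit.retraction_affineElement] at h1
      simp [h1]
    rw [hsum]
    ring
  · rw [Finset.sum_eq_zero, mul_zero, mul_zero]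
    intro u _
    -- A surviving term would make λ/M and λ'/M two points of `F` in one W^aff-orbit, hence equal.
    refine if_neg fun hmem => h ?_
    have heq := WeylOrbit.eq_of_weyl_add_mem_fundamentalDomain hΦ hξ hnorm hlF.1 hlF'.1
      (one_mem _) u.2 hmem
    exact smul_right_injective V (inv_ne_zero (by positivity : (M : ℝ) ≠ 0)) heq
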